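/- Let $n\ge r\ge 0$ and $d>2$ be integers and $S=\mathbb{C}[x_0,\dots,x_n]$. For positive integers $a_1,\dots,a_r$, a complete intersection of type $(a_1,\dots,a_r)$, written $CI(a_1,\dots,a_r)$, is a subscheme $Y\subset\mathbb{P}^n$ whose ideal is generated by forms $F_1,\dots,F_r\in S$ with $\deg F_i=a_i$ that form a regular sequence. The hypersurface $X=\{F=0\}$ contains $Y$ if $(F)\subseteq(F_1,\dots,F_r)$. A property holds for the generic hypersurface of degree $d$ in $\mathbb{P}^n$ if it holds for all hypersurfaces $\{F=0\}$ with $F$ in some nonempty Zariski open set of forms of degree $d$. Suppose that $a_i\in\{1,d-1\}$ for all $i$. Then the generic hypersurface of degree $d$ in $\mathbb{P}^n$ contains a $CI(a_1,\dots,a_r)$ if and only if $$\binom{n-r+d}{d}\le (n-r+1)\,r. \qquad (*)$$ Moreover, if $(*)$ fails, then the generic hypersurface of degree $d$ in $\mathbb{P}^n$ contains no $CI(a_1,\dots,a_r)$. When $a_1=\dots=a_r=1$ this is the non-emptiness criterion for Fano varieties: a hypersurface $X$ of degree $d$ in $\mathbb{P}^n$ contains a $CI(1,\dots,1)$ (with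 $r$ entries $1$) if and only if the Fano variety of $(n-r)$-planes contained in $X$ is non-empty. Hence for the generic $X$ of degree $d$ this Fano variety is non-empty if and only if $(*)$ holds, and if $(*)$ fails it is empty for the generic $X$. -/

import Mathlib

/-- The homogeneous coordinate ring `ℂ[x₀, …, xₙ]` of `ℙⁿ`. -/
abbrev CoordRing (n : ℕ) : Type := MvPolynomial (Fin (n + 1)) ℂ

/-- `I` is the ideal of a complete intersection of type `(a₁, …, a_r)` in `ℙⁿ`: it is generated
by a regular sequence of forms `f₁, …, f_r` with `deg f i = a i`. -/
def IsCompleteIntersectionIdeal {n r : ℕ} (a : Fin r → ℕ) (I : Ideal (CoordRing n)) : Prop :=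
  ∃ f : Fin r → CoordRing n,
    (∀ i, (f i).IsHomogeneous (a i)) ∧
    RingTheory.Sequence.IsRegular (CoordRing n) (List.ofFn f) ∧
    I = Ideal.span (Set.range f)

/-- The hypersurface `F = 0` of `ℙⁿ` contains a `CI(a₁, …, a_r)`: the ideal `(F)` is contained in
the ideal of a complete intersection of type `(a₁, …, a_r)`. -/
def ContainsCI {n r : ℕ} (a : Fin r → ℕ) (F : CoordRing n) : Prop :=
  ∃ I : Ideal (CoordRing n), IsCompleteIntersectionIdeal a I ∧ Ideal.span {F} ≤ I

/-- The Fano variety (as a set) of `k`-planes contained in the hypersurface `F = 0` of `ℙⁿ`.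
A `k`-plane of `ℙⁿ` is given by a linear subspace of dimension `k + 1` of `ℂⁿ⁺¹`. -/
def fanoVariety {n : ℕ} (k : ℕ) (F : CoordRing n) : Set (Submodule ℂ (Fin (n + 1) → ℂ)) :=
  {W | Module.finrank ℂ W = k + 1 ∧ ∀ v ∈ W, MvPolynomial.eval v F = 0}

/-- The generic hypersurface of degree `d` in `ℙⁿ` has the property `P`: there is a nonzero
polynomial `Φ` in the coefficients of degree `d` forms such that every nonzero form `F` of degree
`d` with `Φ(F) ≠ 0` satisfies `P`; in other words, `P` holds on a nonempty Zariski open set of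
forms of degree `d`. -/
def ForGenericHypersurface (n d : ℕ) (P : CoordRing n → Prop) : Prop :=
  ∃ Φ : MvPolynomial {m : Fin (n + 1) →₀ ℕ // m.degree = d} ℂ, Φ ≠ 0 ∧
    ∀ F : CoordRing n, F.IsHomogeneous d → F ≠ 0 →
      MvPolynomial.eval (fun m => MvPolynomial.coeff m.1 F) Φ ≠ 0 → P F

/-!
A form `F` of degree `d` in an ideal generated by forms of degrees `1` and `d - 1` is a sum
`∑ i, L_i G_i` with `L_i` linear and `deg G_i = d - 1`, the two factors playing symmetric roles. So
for each admissible type the question is whether the map `(L, G) ↦ ∑ i, L_i G_i` is dominant, that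
is, whether a generic hypersurface contains an `(n - r)`-plane. Put `N = n - r + 1`.

If `N * r < binom (n - r + d) d`, the forms vanishing on some `(n - r)`-plane are parametrized by
finitely many affine spaces, one for each set `J` of coordinates that are independent on the plane.
Their dimension is the number of forms minus `binom (n - r + d) d` plus the `N * r` parameters of
the plane, which is less than the dimension of the space of forms of degree `d`
(`exists_eval_eq_zero_of_fanoVariety_nonempty`).

If `binom (n - r + d) d ≤ N * r`, take `L_i = x_i + (a linear form in x_r, …, x_n)` and `G_i` a form
in `x_0, …, x_i, x_r, …, x_n`. At `L_i = x_i` and `G_i ∈ ℂ[x_r, …, x_n]` the differential of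
`∑ i, L_i G_i` is surjective as soon as the products `x_k G_i`, `k ≥ r`, span the forms of degree
`d` in `x_r, …, x_n` (`aeval_echelonSum_injective`). For generic `G_i` this is the surjective range
of a theorem of Hochster and Laksov (`exists_pairWith_injective`). For its proof, let a functional
`l ≠ 0` kill all the products, and let it depend essentially on `p` variables. Differentiating the
relations `l (x_k G_i) = 0` with respect to the coefficients of the `G_i` gives `r * p` independent
values of `Θ ↦ (Θ (x_k G_i))_{i,k}` on tangent vectors `Θ` to the variety of functionals in `p`
variables. This variety has dimension `binom (p + d - 1) d + p * (N - p)`, and `l` itself is a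
tangent vector with value zero, so that `r * p < binom (p + d - 1) d + p * (N - p)`; for `d > 2`
this contradicts the assumption (`choose_add_mul_sub_le`). Chevalley's theorem then shows that the
generic `F` is such a sum, with the additional open condition that `x_i ^ (d - 1)` occurs in `G_i`.
Any choice of one of `L_i`, `G_i` for each `i` is a regular sequence by triangularity
(`isRegular_of_triangular`), so that every type is covered.
-/

open Module

/-! ### A binomial inequality and pivots -/

/-- Natural-number form of `c_p / p + (N - p) ≤ c_N / N`, where `c_p = binom(p + e, e + 1)`. It
fails for `e = 1`. -/
lemma choose_add_mul_sub_le {e : ℕ} (he : 2 ≤ e) {p : ℕ} (N : ℕ) (hpN : p ≤ N) :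
    N * (p + e).choose (e + 1) + N * (p * (N - p)) ≤ p * (N + e).choose (e + 1) := by
  induction N, hpN using Nat.le_induction with
  | base => simp
  | succ N hpN ih =>
    rcases Nat.eq_zero_or_pos p with rfl | hp
    · simp
    have hN : 0 < N := hp.trans_le hpN
    have h1 : N * (N + 1 + e).choose (e + 1) = (N + e + 1) * (N + e).choose (e + 1) := by
      have h := Nat.add_one_mul_choose_eq (N + e) e
      have h' := Nat.choose_succ_right_eq (N + e) e
      rw [Nat.add_sub_cancel] at h'
      have h2 := Nat.choose_succ_succ (N + e) e
      rw [Nat.succ_eq_add_one, Nat.succ_eq_add_one] at h2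
      rw [show N + 1 + e = N + e + 1 by ring, h2, mul_add, mul_comm N ((N + e).choose e), ← h']
      ring
    have h2 : N * (N + 1) ≤ e * (N + e).choose (e + 1) := by
      have h3 : (N + 2).choose 3 ≤ (N + e).choose (e + 1) := by
        have h4 : (N + 2).choose (N - 1) ≤ (N + e).choose (N - 1) :=
          Nat.choose_le_choose _ (by omega)
        rwa [← Nat.choose_symm_of_eq_add (show N + 2 = 3 + (N - 1) by omega),
          ← Nat.choose_symm_of_eq_add (show N + e = (e + 1) + (N - 1) by omega)] at h4
      have h5 : N * (N + 1) ≤ 2 * (N + 2).choose 3 := by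
        have h6 := Nat.add_one_mul_choose_eq (N + 1) 2
        have h7 := Nat.add_one_mul_choose_eq N 1
        rw [Nat.choose_one_right] at h7
        norm_num at h6 h7
        have h8 : (N + 2) * ((N + 1) * N) = 6 * (N + 2).choose 3 := by
          rw [h7]; linarith
        nlinarith
      nlinarith
    obtain ⟨k, rfl⟩ := Nat.exists_eq_add_of_le hpN
    rw [show p + k - p = k by omega] at ih
    rw [show p + k + 1 - p = k + 1 by omega]
    refine Nat.le_of_mul_le_mul_left ?_ hN
    generalize (p + k + e).choose (e + 1) = cN at *
    generalize (p + k + 1 + e).choose (e + 1) = cN1 at *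
    generalize (p + e).choose (e + 1) = cp at *
    have e1 : (p + k) * (p * cN1) = p * ((p + k + e + 1) * cN) := by rw [← h1]; ring
    rw [e1]
    have e2 := Nat.mul_le_mul_left (p + k + 1) ih
    have e3 := Nat.mul_le_mul_left p h2
    linarith

/-- A finite family in a vector space has a subfamily that is a basis of its span. -/
lemma exists_pivots {K ι V : Type*} [Field K] [AddCommGroup V] [Module K V] [Finite ι]
    (v : ι → V) (hv : Submodule.span K (Set.range v) = ⊤) :
    ∃ J : Finset ι, J.card = finrank K V ∧ ∀ k, ∃ c : J → K, v k = ∑ t, c t • v t := by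
  classical
  obtain ⟨κ, a, ha, hs, hli⟩ := exists_linearIndependent' K v
  have : Finite κ := Finite.of_injective a ha
  have := Fintype.ofFinite κ
  have := Fintype.ofFinite ι
  have hsp : Submodule.span K (Set.range (v ∘ a)) = ⊤ := hs.trans hv
  let b : Basis κ K V := Basis.mk hli hsp.ge
  let f : κ ≃ (Finset.univ.image a : Finset ι) :=
    Equiv.ofBijective (fun t => ⟨a t, by simp⟩)
      ⟨fun x y h => ha (by simpa using h), fun ⟨y, hy⟩ => by
        obtain ⟨t, -, rfl⟩ := Finset.mem_image.1 hy; exact ⟨t, rfl⟩⟩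
  refine ⟨Finset.univ.image a, ?_, fun k => ⟨fun t => b.repr (v k) (f.symm t), ?_⟩⟩
  · rw [Finset.card_image_of_injective _ ha, finrank_eq_card_basis b, Finset.card_univ]
  · rw [← f.sum_comp]
    conv_lhs => rw [← b.sum_repr (v k)]
    refine Finset.sum_congr rfl fun t _ => ?_
    simp only [f.symm_apply_apply]
    rw [Basis.mk_apply]
    rfl

/-! ### Contracting functionals on forms -/

section Contraction

variable {K : Type*} [Field K] {σ : Type*} [Fintype σ] {e : ℕ}

/-- A functional `l` on forms of degree `e + 1` in the variables `σ`, given by its values on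
monomials, is contracted with a linear form `c` to the functional `f ↦ l (c f)` on forms of
degree `e`. -/
def contract : (σ → K) →ₗ[K] (Sym σ (e + 1) → K) →ₗ[K] (Sym σ e → K) :=
  LinearMap.mk₂ K (fun c l β => ∑ j, c j * l (j ::ₛ β))
    (fun _ _ _ => by ext; simp [add_mul, Finset.sum_add_distrib])
    (fun _ _ _ => by ext; simp [Finset.mul_sum, mul_assoc])
    (fun _ _ _ => by ext; simp [mul_add, Finset.sum_add_distrib])
    (fun _ _ _ => by ext; simp [Finset.mul_sum, mul_left_comm])

lemma contract_apply (c : σ → K) (l : Sym σ (e + 1) → K) (β : Sym σ e) :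
    contract c l β = ∑ j, c j * l (j ::ₛ β) := rfl

/-- The functionals on forms of degree `e + 1` that are killed by a space `Z` of linear forms. -/
def annihilatedBy (Z : Submodule K (σ → K)) : Submodule K (Sym σ (e + 1) → K) where
  carrier := {l | ∀ c ∈ Z, contract c l = 0}
  add_mem' h1 h2 c hc := by rw [map_add, h1 c hc, h2 c hc, add_zero]
  zero_mem' c _ := map_zero _
  smul_mem' a l h c hc := by rw [map_smul, h c hc, smul_zero]

/-- The variables can be split into `p` variables and `N - p` variables each of which is congruent
modulo `Z` to a combination of the former. A functional killed by `Z` is thus determined by its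
values on monomials in `p` variables. -/
lemma finrank_annihilatedBy_le (Z : Submodule K (σ → K)) {p : ℕ}
    (hp : p + finrank K Z = Fintype.card σ) (hp0 : 1 ≤ p) :
    finrank K (annihilatedBy (e := e) Z) ≤ (p + e).choose (e + 1) := by
  classical
  have hspan : Submodule.span K (Set.range fun k : σ => Z.mkQ (Pi.single k 1)) = ⊤ := by
    have h : (fun k : σ => Z.mkQ (Pi.single k 1)) = Z.mkQ ∘ (Pi.basisFun K σ) := by
      ext k; simp
    rw [h, Set.range_comp, Submodule.span_image, Basis.span_eq, Submodule.map_top,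
      Submodule.range_mkQ]
  obtain ⟨J, hJ, hc⟩ := exists_pivots _ hspan
  have hJp : J.card = p := by
    have h1 := Z.finrank_quotient_add_finrank
    rw [finrank_fintype_fun_eq_card] at h1
    omega
  let res : annihilatedBy (e := e) Z →ₗ[K] (Sym J (e + 1) → K) :=
    { toFun := fun l s => l.1 (s.map Subtype.val)
      map_add' := fun _ _ => rfl
      map_smul' := fun _ _ => rfl }
  have hinj : Function.Injective res := by
    rw [injective_iff_map_eq_zero]
    rintro ⟨l, hl⟩ h0
    have h0' : ∀ s : Sym J (e + 1), l (s.map Subtype.val) = 0 := fun s => congrFun h0 s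
    -- induction on the number of variables outside `J`
    have key : ∀ (q : ℕ) (t : Multiset σ) (u : Multiset J) (_ : Multiset.card t = q)
        (h : Multiset.card (t + u.map Subtype.val) = e + 1),
        l ⟨t + u.map Subtype.val, h⟩ = 0 := by
      intro q
      induction q with
      | zero =>
        intro t u ht h
        obtain rfl := Multiset.card_eq_zero.1 ht
        have hu : Multiset.card u = e + 1 := by simpa using h
        rw [← h0' ⟨u, hu⟩]
        congr 1
        apply Subtype.ext
        simp
      | succ q ih =>
        intro t u ht h
        obtain ⟨k, t', rfl⟩ := Multiset.card_pos_iff_exists_mem.1 (by omega : 0 < Multiset.card t)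
          |>.imp fun k hk => Multiset.exists_cons_of_mem hk
        have ht' : Multiset.card t' = q := by simpa using ht
        obtain ⟨β, hβ⟩ : ∃ β : Sym σ e, (β : Multiset σ) = t' + u.map Subtype.val :=
          ⟨⟨t' + u.map Subtype.val, by simpa [add_right_comm _ 1] using h⟩, rfl⟩
        have hβc : Multiset.card (t' + u.map Subtype.val) = e := hβ ▸ β.2
        obtain ⟨c, hck⟩ := hc k
        have hmem : (Pi.single k 1 - ∑ t, c t • Pi.single t.1 1 : σ → K) ∈ Z := by
          rw [← Submodule.Quotient.mk_eq_zero, ← Submodule.mkQ_apply, map_sub, hck]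
          simp
        have h1 : contract (Pi.single k 1 - ∑ t, c t • Pi.single t.1 1 : σ → K) l β = 0 :=
          congrFun (hl _ hmem) β
        have h2 : ∀ i : J, l (i.1 ::ₛ β) = 0 := by
          intro i
          rw [← ih t' (i ::ₘ u) ht' (by simp at hβc ⊢; omega)]
          congr 1
          apply Subtype.ext
          simp [Sym.cons, hβ]
        have h3 : l (k ::ₛ β) = 0 := by
          have h4 : ∀ (k : σ) (β : Sym σ e), contract (Pi.single k 1) l β = l (k ::ₛ β) := by
            intro k β
            simp [contract_apply, Pi.single_apply]
          rw [map_sub, map_sum, LinearMap.sub_apply, LinearMap.sum_apply, Pi.sub_apply,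
            Finset.sum_apply, h4] at h1
          simpa [h4, h2] using h1
        rw [← h3]
        congr 1
        apply Subtype.ext
        simp [Sym.cons, hβ]
    ext s
    have := key (e + 1) s.1 0 s.2 (by simp)
    have hs : (⟨s.1 + Multiset.map Subtype.val (0 : Multiset J), by simp⟩ : Sym σ (e + 1)) = s :=
      Subtype.ext (by simp)
    rwa [hs] at this
  have h1 := LinearMap.finrank_le_finrank_of_injective hinj
  rw [finrank_fintype_fun_eq_card, Sym.card_sym_eq_choose, Fintype.card_coe, hJp] at h1
  rwa [show p + (e + 1) - 1 = p + e by omega] at h1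

/-- The functionals whose contractions with `Z` lie in `W`. With `Z` and `W` the kernel and the
range of `c ↦ contract c l` this contains the tangent space at `l` of the variety of functionals
that depend on `dim W` variables only. -/
def contractsInto (Z : Submodule K (σ → K)) (W : Submodule K (Sym σ e → K)) :
    Submodule K (Sym σ (e + 1) → K) where
  carrier := {l | ∀ c ∈ Z, contract c l ∈ W}
  add_mem' h1 h2 c hc := by rw [map_add]; exact W.add_mem (h1 c hc) (h2 c hc)
  zero_mem' c _ := by rw [map_zero]; exact W.zero_mem
  smul_mem' a l h c hc := by rw [map_smul]; exact W.smul_mem a (h c hc)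

/-- `l ↦ (c ↦ contract c l)` maps `contractsInto Z W` to `Hom(Z, W)` with kernel
`annihilatedBy Z`. -/
lemma finrank_contractsInto_le (Z : Submodule K (σ → K)) (W : Submodule K (Sym σ e → K)) {p : ℕ}
    (hp : p + finrank K Z = Fintype.card σ) (hW : finrank K W = p) (hp0 : 1 ≤ p) :
    finrank K (contractsInto Z W) ≤
      (p + e).choose (e + 1) + p * (Fintype.card σ - p) := by
  classical
  let f : contractsInto Z W →ₗ[K] (Z →ₗ[K] W) :=
    { toFun := fun l =>
        { toFun := fun c => ⟨contract c.1 l.1, l.2 c.1 c.2⟩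
          map_add' := fun _ _ => by ext; simp
          map_smul' := fun _ _ => by ext; simp }
      map_add' := fun _ _ => by ext; simp
      map_smul' := fun _ _ => by ext; simp }
  have h1 := LinearMap.finrank_range_add_finrank_ker (V₂ := Z →ₗ[K] W) f
  have h2 : finrank K f.range ≤ p * (Fintype.card σ - p) := by
    refine (Submodule.finrank_le _).trans ?_
    rw [finrank_linearMap, hW, mul_comm]
    exact Nat.mul_le_mul_left _ (by omega)
  have h3 : finrank K f.ker ≤ finrank K (annihilatedBy (e := e) Z) := by
    let g : f.ker →ₗ[K] annihilatedBy (e := e) Z :=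
      ((contractsInto Z W).subtype ∘ₗ f.ker.subtype).codRestrict _ (by
        rintro ⟨l, hl⟩ c hc
        exact congrArg Subtype.val (LinearMap.congr_fun (LinearMap.mem_ker.1 hl) ⟨c, hc⟩))
    refine LinearMap.finrank_le_finrank_of_injective (f := g) fun x y h => ?_
    have := congrArg Subtype.val h
    exact Subtype.ext (Subtype.ext this)
  have h4 := finrank_annihilatedBy_le (e := e) Z hp hp0
  omega

variable [DecidableEq σ]

/-- The values of a functional on the products `x_j G_i`. -/
def pairWith {r : ℕ} (G : Fin r → Sym σ e → K) : (Sym σ (e + 1) → K) →ₗ[K] (Fin r → σ → K) where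
  toFun l i j := ∑ β, G i β * l (j ::ₛ β)
  map_add' _ _ := by
    ext
    simp only [Pi.add_apply, mul_add, Finset.sum_add_distrib]
  map_smul' _ _ := by
    ext
    simp only [Pi.smul_apply, smul_eq_mul, Finset.mul_sum, mul_left_comm, RingHom.id_apply]

/-- If a nonzero functional `l` annihilates all `x_j G_i`, then the tangent space estimate bounds
the number of independent values that `pairWith G` takes on `contractsInto`; so it cannot take all
the values `Pi.single i (j ↦ l (x_j α))`. -/
lemma not_forall_mem_map_pairWith {r : ℕ} (he : 2 ≤ e) [Nonempty σ]
    (hr : (Fintype.card σ + e).choose (e + 1) ≤ Fintype.card σ * r)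
    (G : Fin r → Sym σ e → K) (l : Sym σ (e + 1) → K) (hl : l ≠ 0) (hG : pairWith G l = 0)
    (h : ∀ (i : Fin r) (α : Sym σ e), Pi.single i (fun j => l (j ::ₛ α)) ∈
      (contractsInto (contract.flip l).ker (contract.flip l).range).map (pairWith G)) : False := by
  classical
  set Z := (contract.flip l).ker with hZ
  set W := (contract.flip l).range with hW
  set T := contractsInto Z W with hT
  obtain ⟨p, hp⟩ : ∃ p, p = finrank K W := ⟨_, rfl⟩
  have hpZ : p + finrank K Z = Fintype.card σ := by
    rw [hp, hW, hZ, LinearMap.finrank_range_add_finrank_ker, finrank_fintype_fun_eq_card]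
  have hp0 : 1 ≤ p := by
    rw [hp]
    by_contra! h0
    have hbot : W = ⊥ := Submodule.finrank_eq_zero.1 (by omega)
    apply hl
    ext s
    obtain ⟨j, β, rfl⟩ := s.exists_eq_cons_of_succ
    have : contract.flip l (Pi.single j 1) = 0 := by
      rw [← Submodule.mem_bot K, ← hbot]; exact ⟨_, rfl⟩
    simpa [contract_apply, Pi.single_apply] using congrFun this β
  have hlT : l ∈ T := fun c hc => by
    have : contract c l = 0 := hc
    rw [this]; exact W.zero_mem
  have h1 : finrank K (T.map (pairWith G)) + 1 ≤ finrank K T := by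
    have h2 := ((pairWith G).domRestrict T).finrank_range_add_finrank_ker
    rw [LinearMap.range_domRestrict] at h2
    rw [← h2]
    refine Nat.add_le_add_left (Nat.one_le_iff_ne_zero.2 fun h0 => hl ?_) _
    have hbot := Submodule.finrank_eq_zero.1 h0
    have hmem : (⟨l, hlT⟩ : T) ∈ ((pairWith G).domRestrict T).ker := by
      simpa using hG
    rw [hbot] at hmem
    exact congrArg Subtype.val ((Submodule.mem_bot K).1 hmem)
  let A : Matrix (Sym σ e) σ K := fun α j => l (j ::ₛ α)
  let R : Submodule K (σ → K) := Submodule.span K (Set.range A.row)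
  have hR : finrank K R = p := by
    rw [← A.rank_eq_finrank_span_row, hp, hW, Matrix.rank]
    have : A.mulVecLin = contract.flip l := by
      ext c β
      have h1 : contract (Pi.single c 1) l β = l (c ::ₛ β) := by
        simp [contract_apply, Pi.single_apply]
      have h2 : A.mulVecLin (Pi.single c 1) β = A β c := by simp
      exact h2.trans h1.symm
    rw [this]
  have h3 : r * p ≤ finrank K (T.map (pairWith G)) := by
    let f : (Fin r → R) →ₗ[K] T.map (pairWith G) :=
      (LinearMap.pi fun i => R.subtype ∘ₗ LinearMap.proj i).codRestrict _ (by
        intro x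
        have hx : (LinearMap.pi fun i => R.subtype ∘ₗ LinearMap.proj i) x =
            ∑ i, Pi.single i (x i).1 := by
          ext i j
          simp [Finset.sum_apply, Pi.single_apply, ite_apply]
        rw [hx]
        refine Submodule.sum_mem _ fun i _ => ?_
        have : R ≤ (T.map (pairWith G)).comap (LinearMap.single K (fun _ => σ → K) i) := by
          refine Submodule.span_le.2 ?_
          rintro _ ⟨α, rfl⟩
          exact h i α
        exact this (x i).2)
    have hf : Function.Injective f := by
      intro x y hxy
      ext i j
      have := congrArg Subtype.val hxy
      exact congrFun (congrFun this i) j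
    have := LinearMap.finrank_le_finrank_of_injective hf
    simpa [finrank_pi_fintype, hR] using this
  have h4 : finrank K T ≤ _ := finrank_contractsInto_le Z W hpZ hp.symm hp0
  have hpN : p ≤ Fintype.card σ := by omega
  have h5 := choose_add_mul_sub_le he _ hpN
  have hN : 0 < Fintype.card σ := Fintype.card_pos
  have h6 : Fintype.card σ * ((p + e).choose (e + 1) + p * (Fintype.card σ - p)) ≤
      Fintype.card σ * (p * r) := by
    calc _ ≤ p * (Fintype.card σ + e).choose (e + 1) := by rw [mul_add]; exact h5
      _ ≤ p * (Fintype.card σ * r) := Nat.mul_le_mul_left _ hr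
      _ = _ := by ring
  have h7 := Nat.le_of_mul_le_mul_left h6 hN
  rw [mul_comm p r] at h7
  omega

end Contraction

/-! ### Generic forms -/

section Generic

open MvPolynomial

variable {k : Type*} [Field k] {σ : Type*} [Fintype σ] [DecidableEq σ] {e r : ℕ}

/-- A finite family in a fraction field has a common denominator. -/
lemma exists_smul_eq_algebraMap {P K ι : Type*} [CommRing P] [IsDomain P] [Field K] [Algebra P K]
    [IsFractionRing P K] [Finite ι] (f : ι → K) :
    ∃ b : P, b ≠ 0 ∧ ∃ g : ι → P, ∀ i, algebraMap P K (g i) = algebraMap P K b * f i := by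
  obtain ⟨b, hb⟩ := IsLocalization.exist_integer_multiples_of_finite (nonZeroDivisors P) f
  choose g hg using hb
  exact ⟨b, nonZeroDivisors.ne_zero b.2, g, fun i => by rw [hg, Algebra.smul_def]⟩

/-- Differentiating `∑ β, G i β * l (j β) = 0` with respect to the coefficient `α` of `G i` shows
that the derivative of `l` takes the value `-Pi.single i (j ↦ l (j α))`; differentiating
`∑ j, c j * l (j β) = 0` shows that it lies in `contractsInto`. -/
lemma pairWith_generic_injective (he : 2 ≤ e) [Nonempty σ]
    (hr : (Fintype.card σ + e).choose (e + 1) ≤ Fintype.card σ * r)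
    {K : Type*} [Field K] [Algebra (MvPolynomial (Fin r × Sym σ e) k) K]
    [IsFractionRing (MvPolynomial (Fin r × Sym σ e) k) K] :
    Function.Injective (pairWith fun (i : Fin r) (β : Sym σ e) =>
      algebraMap (MvPolynomial (Fin r × Sym σ e) k) K (X (i, β))) := by
  classical
  set P := MvPolynomial (Fin r × Sym σ e) k
  let φ := algebraMap P K
  have hφ : Function.Injective φ := IsFractionRing.injective P K
  rw [injective_iff_map_eq_zero]
  intro l₀ hl₀
  by_contra hne
  obtain ⟨b, hb, l, hl⟩ := exists_smul_eq_algebraMap (P := P) l₀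
  have hlb : (fun s => φ (l s)) = φ b • l₀ := funext hl
  have hL0 : (fun s => φ (l s)) ≠ 0 := by
    rw [hlb]
    exact smul_ne_zero (fun h => hb (hφ (by simpa using h))) hne
  have hLG : pairWith (fun i β => φ (X (i, β))) (fun s => φ (l s)) = 0 := by
    rw [hlb, map_smul, hl₀, smul_zero]
  refine not_forall_mem_map_pairWith he hr _ _ hL0 hLG fun i α => ?_
  let D := pderiv (R := k) (i, α)
  refine ⟨fun s => - φ (D (l s)), fun c hc => ?_, ?_⟩
  · obtain ⟨b, hb, c', hc'⟩ := exists_smul_eq_algebraMap (P := P) c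
    have hφb : φ b ≠ 0 := fun h => hb (hφ (by simpa using h))
    have h1 : ∀ β : Sym σ e, ∑ j, c' j * l (j ::ₛ β) = 0 := by
      intro β
      apply hφ
      have h2 : contract c (fun s => φ (l s)) β = 0 := congrFun hc β
      rw [contract_apply] at h2
      rw [map_sum, map_zero]
      calc _ = ∑ j, φ b * (c j * φ (l (j ::ₛ β))) := by
            refine Finset.sum_congr rfl fun j _ => ?_
            rw [map_mul, hc', mul_assoc]
        _ = 0 := by rw [← Finset.mul_sum, h2, mul_zero]
    refine ⟨(φ b)⁻¹ • fun j => φ (D (c' j)), ?_⟩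
    rw [map_smul, inv_smul_eq_iff₀ hφb]
    ext β
    have h2 := congrArg (fun x => φ (D x)) (h1 β)
    simp only [map_sum, Derivation.leibniz, map_add, map_zero, smul_eq_mul, map_mul,
      Finset.sum_add_distrib] at h2
    simp only [LinearMap.flip_apply, contract_apply, Pi.smul_apply, smul_eq_mul, mul_neg,
      Finset.sum_neg_distrib, Finset.mul_sum, ← mul_assoc]
    rw [eq_neg_iff_add_eq_zero, ← h2, add_comm]
    congr 1
    · refine Finset.sum_congr rfl fun j _ => ?_
      rw [hc']
    · exact Finset.sum_congr rfl fun j _ => mul_comm _ _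
  · ext i' j
    have h1 : ∑ β, (X (i', β) : P) * l (j ::ₛ β) = 0 := by
      apply hφ
      have := congrFun (congrFun hLG i') j
      rw [map_sum, map_zero]
      simpa [pairWith] using this
    have h2 := congrArg (fun x => φ (D x)) h1
    simp only [map_sum, Derivation.leibniz, map_add, map_zero, smul_eq_mul, map_mul,
      Finset.sum_add_distrib] at h2
    have h3 : ∑ β, φ (l (j ::ₛ β)) * φ (D (X (i', β))) =
        Pi.single (M := fun _ => σ → K) i (fun j => φ (l (j ::ₛ α))) i' j := by
      rcases eq_or_ne i' i with rfl | hi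
      · rw [Pi.single_eq_same, Finset.sum_eq_single α]
        · simp [D]
        · intro β _ hβ
          simp [D, -pderiv_X,
            pderiv_X_of_ne (R := k) (i := (i', α)) (j := (i', β)) (by simpa using hβ)]
        · simp
      · rw [Pi.single_eq_of_ne hi]
        refine Finset.sum_eq_zero fun β _ => ?_
        simp [D, -pderiv_X, pderiv_X_of_ne (R := k) (i := (i, α)) (j := (i', β)) (by simp [hi])]
    rw [h3] at h2
    simp only [pairWith, LinearMap.coe_mk, AddHom.coe_mk, mul_neg, Finset.sum_neg_distrib]
    rw [neg_eq_iff_add_eq_zero]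
    exact h2

/-- Forms of degree `e ≥ 2` in `N` variables whose products with the variables span all forms of
degree `e + 1` exist as soon as there are enough such products; this is the surjective range of
the theorem of Hochster and Laksov. -/
theorem exists_pairWith_injective [Infinite k] (he : 2 ≤ e) [Nonempty σ]
    (hr : (Fintype.card σ + e).choose (e + 1) ≤ Fintype.card σ * r) :
    ∃ G : Fin r → Sym σ e → k, ∀ l, pairWith G l = 0 → l = 0 := by
  classical
  set P := MvPolynomial (Fin r × Sym σ e) k
  let K := FractionRing P
  let φ := algebraMap P K
  have hφ : Function.Injective φ := IsFractionRing.injective P K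
  obtain ⟨B, hB⟩ := LinearMap.exists_leftInverse_of_injective _
    (LinearMap.ker_eq_bot.2 (pairWith_generic_injective (k := k) (K := K) he hr))
  obtain ⟨δ, hδ, B', hB'⟩ := exists_smul_eq_algebraMap (P := P)
    (fun x : Sym σ (e + 1) × Fin r × σ => B (Pi.single x.2.1 (Pi.single x.2.2 1)) x.1)
  obtain ⟨G, hG⟩ : ∃ G, eval G δ ≠ 0 := by
    by_contra! h
    exact hδ (MvPolynomial.funext fun x => by simp [h x])
  refine ⟨fun i β => G (i, β), fun l hl => ?_⟩
  ext s
  have h1 : δ * C (l s) = ∑ i, ∑ j, B' (s, i, j) * ∑ β, X (i, β) * C (l (j ::ₛ β)) := by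
    apply hφ
    have h2 := congrFun (LinearMap.congr_fun hB fun s => φ (C (l s))) s
    set y := pairWith (fun i β => φ (X (i, β))) fun s => φ (C (l s)) with hy
    have h3 : y = ∑ i, ∑ j, y i j • Pi.single i (Pi.single j 1) := by
      ext i j
      simp [Finset.sum_apply, Pi.single_apply, ite_apply]
    have h4 : B y s = φ (C (l s)) := h2
    rw [h3] at h4
    simp only [map_sum, map_smul, Finset.sum_apply, Pi.smul_apply, smul_eq_mul] at h4
    simp only [map_mul, map_sum]
    rw [← h4, Finset.mul_sum]
    refine Finset.sum_congr rfl fun i _ => ?_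
    rw [Finset.mul_sum]
    refine Finset.sum_congr rfl fun j _ => ?_
    rw [hB', hy]
    simp only [pairWith, LinearMap.coe_mk, AddHom.coe_mk]
    ring
  have h2 := congrArg (eval G) h1
  have h3 : ∀ i j, ∑ β, G (i, β) * l (j ::ₛ β) = 0 := fun i j => congrFun (congrFun hl i) j
  simpa [map_sum, h3, hG] using h2

end Generic

/-! ### Dominant polynomial maps -/

section PolynomialMaps

open MvPolynomial

variable {k : Type*} [Field k] {μ ζ : Type*}

lemma pderiv_aeval_eq_sum [Fintype μ] (y : μ → MvPolynomial ζ k) (j : ζ) (Φ : MvPolynomial μ k) :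
    pderiv j (aeval y Φ) = ∑ m, aeval y (pderiv m Φ) * pderiv j (y m) := by
  classical
  induction Φ using MvPolynomial.induction_on with
  | C a => simp
  | add p q hp hq => simp only [map_add, hp, hq, add_mul, Finset.sum_add_distrib]
  | mul_X p i hp =>
    have h1 : ∀ m : μ, aeval y (pderiv m (p * X i)) * pderiv j (y m) =
        aeval y p * (aeval y (pderiv m (X i : MvPolynomial μ k)) * pderiv j (y m)) +
          y i * (aeval y (pderiv m p) * pderiv j (y m)) := by
      intro m
      rw [Derivation.leibniz, smul_eq_mul, smul_eq_mul, map_add, map_mul, map_mul, aeval_X]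
      ring
    have h2 : ∑ m, aeval y (pderiv m (X i : MvPolynomial μ k)) * pderiv j (y m) =
        pderiv j (y i) := by
      rw [Finset.sum_eq_single i]
      · rw [pderiv_X_self, map_one, one_mul]
      · intro m _ hm
        rw [pderiv_X_of_ne hm.symm, map_zero, zero_mul]
      · simp
    simp only [h1, Finset.sum_add_distrib, ← Finset.mul_sum, h2, ← hp]
    rw [map_mul, aeval_X, Derivation.leibniz, smul_eq_mul, smul_eq_mul]

lemma totalDegree_pderiv_lt (m : μ) {Φ : MvPolynomial μ k} (h : pderiv m Φ ≠ 0) :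
    (pderiv m Φ).totalDegree < Φ.totalDegree := by
  obtain ⟨s, hs, hd⟩ := Finset.exists_mem_eq_sup (pderiv m Φ).support (support_nonempty.2 h)
    fun s => s.sum fun _ e => e
  have h1 : s + Finsupp.single m 1 ∈ Φ.support := by
    rw [MvPolynomial.mem_support_iff, coeff_pderiv] at hs
    exact MvPolynomial.mem_support_iff.2 (left_ne_zero_of_mul hs)
  have h2 := le_totalDegree h1
  rw [Finsupp.sum_add_index' (by simp) (by simp), Finsupp.sum_single_index rfl] at h2
  rw [totalDegree, hd]
  omega

lemma eq_C_of_forall_pderiv_eq_zero [CharZero k] {Φ : MvPolynomial μ k}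
    (h : ∀ m, pderiv m Φ = 0) : ∃ c, Φ = C c := by
  classical
  refine ⟨coeff 0 Φ, ?_⟩
  ext s
  rw [coeff_C]
  split_ifs with hs
  · rw [hs]
  · obtain ⟨m, hm⟩ := Finsupp.ne_iff.1 (Ne.symm hs)
    have h1 := congrArg (coeff (s - Finsupp.single m 1)) (h m)
    have h2 : s - Finsupp.single m 1 + Finsupp.single m 1 = s :=
      tsub_add_cancel_of_le (by simpa using Nat.one_le_iff_ne_zero.2 hm)
    rw [coeff_pderiv, h2, coeff_zero] at h1
    refine (mul_eq_zero.1 h1).resolve_right ?_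
    exact Nat.cast_add_one_ne_zero _

/-- In characteristic zero, a polynomial map whose differential is surjective at one point is
dominant. -/
lemma aeval_injective_of_jacobian [CharZero k] [Fintype μ] [Finite ζ] (y : μ → MvPolynomial ζ k)
    (z : ζ → k)
    (h : ∀ v : μ → k, (∀ j, ∑ m, v m * eval z (pderiv j (y m)) = 0) → v = 0) :
    Function.Injective (aeval y : MvPolynomial μ k →ₐ[k] MvPolynomial ζ k) := by
  classical
  have := Fintype.ofFinite ζ
  let Jac : Matrix μ ζ (MvPolynomial ζ k) := Matrix.of fun m j => pderiv j (y m)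
  let Jz : Matrix μ ζ k := Matrix.of fun m j => eval z (pderiv j (y m))
  have hker : Jz.vecMulLinear.ker = ⊥ := by
    rw [LinearMap.ker_eq_bot']
    exact fun v hv => h v fun j => congrFun hv j
  obtain ⟨g, hg⟩ := LinearMap.exists_leftInverse_of_injective _ hker
  let B : Matrix ζ μ k := LinearMap.toMatrixRight' g
  have hB : Jz * B = 1 := by
    apply Matrix.toLinearMapRight'.injective
    rw [Matrix.toLinearMapRight'_mul, Matrix.toLinearMapRight'_one]
    have hBg : Matrix.toLinearMapRight' B = g := by simp [B]
    rw [hBg]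
    exact hg
  let BC : Matrix ζ μ (MvPolynomial ζ k) := B.map C
  have hdet : (Jac * BC).det ≠ 0 := by
    intro h0
    have h1 : eval z (Jac * BC).det = 0 := by rw [h0, map_zero]
    rw [RingHom.map_det] at h1
    have h2 : (eval z).mapMatrix (Jac * BC) = Jz * B := by
      ext a b
      simp [Matrix.mul_apply, Jac, Jz, BC]
    rw [h2, hB, Matrix.det_one] at h1
    exact one_ne_zero h1
  rw [injective_iff_map_eq_zero]
  intro Φ
  -- induction on the degree: the partial derivatives of a relation are relations
  induction hd : Φ.totalDegree using Nat.strong_induction_on generalizing Φ with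
  | _ d ih =>
    intro hΦ
    have h1 : ∀ m, aeval y (pderiv m Φ) = 0 := by
      have h2 : Matrix.vecMul (fun m => aeval y (pderiv m Φ)) (Jac * BC) = 0 := by
        have h3 : Matrix.vecMul (fun m => aeval y (pderiv m Φ)) Jac = 0 := by
          ext j : 1
          have h4 := pderiv_aeval_eq_sum y j Φ
          rw [hΦ, map_zero] at h4
          exact h4.symm
        rw [← Matrix.vecMul_vecMul, h3, Matrix.zero_vecMul]
      exact congrFun (Matrix.eq_zero_of_vecMul_eq_zero hdet h2)
    have h2 : ∀ m, pderiv m Φ = 0 := by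
      intro m
      by_contra hne
      exact hne (ih _ (hd ▸ totalDegree_pderiv_lt m hne) _ rfl (h1 m))
    obtain ⟨c, rfl⟩ := eq_C_of_forall_pderiv_eq_zero h2
    rw [← algebraMap_eq, AlgHom.commutes, algebraMap_eq, C_eq_zero] at hΦ
    rw [hΦ, C_0]

/-- The image of a dominant polynomial map, and even the image of the complement of a
hypersurface, contains the complement of a hypersurface (Chevalley's theorem combined with the
Nullstellensatz). -/
lemma exists_forall_eval_ne_zero_imp_mem_image [IsAlgClosed k] [Finite μ] [Finite ζ]
    (y : μ → MvPolynomial ζ k)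
    (hy : Function.Injective (aeval y : MvPolynomial μ k →ₐ[k] MvPolynomial ζ k))
    {b : MvPolynomial ζ k} (hb : b ≠ 0) :
    ∃ a : MvPolynomial μ k, a ≠ 0 ∧ ∀ x : μ → k, eval x a ≠ 0 →
      ∃ z : ζ → k, (∀ m, eval z (y m) = x m) ∧ eval z b ≠ 0 := by
  let φ : MvPolynomial μ k →+* MvPolynomial ζ k := (aeval y).toRingHom
  have hφ : φ.FinitePresentation := by
    rw [← RingHom.FinitePresentation.of_finiteType]
    refine RingHom.FiniteType.of_comp_finiteType (f := C) ?_
    have : φ.comp C = algebraMap k _ := by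
      ext a : 1
      simp [φ, algebraMap_eq]
    rw [this, RingHom.finiteType_algebraMap]
    infer_instance
  have hb' : Topology.IsConstructible
      ((PrimeSpectrum.basicOpen b : TopologicalSpace.Opens _) :
        Set (PrimeSpectrum (MvPolynomial ζ k))) :=
    (PrimeSpectrum.isCompact_basicOpen b).isConstructible (PrimeSpectrum.basicOpen b).isOpen
  obtain ⟨S, hS⟩ := PrimeSpectrum.exists_constructibleSetData_iff.2
    (PrimeSpectrum.isConstructible_comap_image hφ hb')
  have hgen : (⊥ : PrimeSpectrum (MvPolynomial μ k)) ∈ S.toSet := by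
    rw [hS]
    refine ⟨⊥, ?_, ?_⟩
    · simpa using hb
    · ext1
      exact (RingHom.injective_iff_ker_eq_bot _).1 hy
  -- the piece of the constructible image through the generic point is open
  simp only [PrimeSpectrum.ConstructibleSetData.toSet, Set.mem_iUnion] at hgen
  obtain ⟨D, hDS, hDg, hDf⟩ := hgen
  refine ⟨D.f, ?_, fun x hx => ?_⟩
  · intro h0
    apply hDf
    simp [h0]
  have hg0 : ∀ i, D.g i = 0 := fun i => by
    have := hDg ⟨i, rfl⟩
    simpa using this
  let I : Ideal (MvPolynomial μ k) := vanishingIdeal k {x}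
  have hI : I.IsMaximal := isMaximal_iff_eq_vanishingIdeal_singleton.2 ⟨x, rfl⟩
  have hmem : (⟨I, hI.isPrime⟩ : PrimeSpectrum (MvPolynomial μ k)) ∈ S.toSet := by
    simp only [PrimeSpectrum.ConstructibleSetData.toSet, Set.mem_iUnion]
    refine ⟨D, hDS, ?_, ?_⟩
    · rintro _ ⟨i, rfl⟩
      rw [hg0 i]
      exact I.zero_mem
    · intro h
      have h1 : D.f ∈ I := h rfl
      rw [mem_vanishingIdeal_singleton_iff] at h1
      exact hx h1
  rw [hS] at hmem
  obtain ⟨q, hbq, hq⟩ := hmem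
  have hbq' : b ∉ q.asIdeal := hbq
  have hcomap : q.asIdeal.comap φ = I := congrArg PrimeSpectrum.asIdeal hq
  rw [← q.2.radical, ← vanishingIdeal_zeroLocus_eq_radical (K := k), mem_vanishingIdeal_iff]
    at hbq'
  push Not at hbq'
  obtain ⟨z, hz, hbz⟩ := hbq'
  refine ⟨z, fun m => ?_, by simpa using hbz⟩
  have h1 : (X m - C (x m) : MvPolynomial μ k) ∈ q.asIdeal.comap φ := by
    rw [hcomap, mem_vanishingIdeal_singleton_iff]
    simp
  have h2 := mem_zeroLocus_iff.1 hz _ h1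
  simpa [φ, sub_eq_zero, algebraMap_eq] using h2

/-- A polynomial map to an affine space of larger dimension is not dominant. -/
lemma exists_ne_zero_aeval_eq_zero [Fintype μ] [Fintype ζ] (y : μ → MvPolynomial ζ k)
    (h : Fintype.card ζ < Fintype.card μ) : ∃ Φ : MvPolynomial μ k, Φ ≠ 0 ∧ aeval y Φ = 0 := by
  by_contra! hcon
  have hind : AlgebraicIndependent k y := by
    rw [AlgebraicIndependent, injective_iff_map_eq_zero]
    exact fun Φ hΦ => by_contra fun hne => hcon Φ hne hΦ
  have h1 := hind.lift_cardinalMk_le_trdeg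
  rw [trdeg_of_isDomain, Cardinal.mk_fintype, Cardinal.mk_fintype] at h1
  simp at h1
  omega

end PolynomialMaps

/-! ### Triangular regular sequences -/

section RegularSequences

open MvPolynomial

variable {k : Type*} [Field k] {τ : Type*}

lemma apply_lt_of_degree_eq {m : τ →₀ ℕ} {i : τ} (hm : m ≠ Finsupp.single i m.degree) :
    m i < m.degree := by
  classical
  refine lt_of_le_of_ne (Finsupp.le_degree i m) fun h => hm ?_
  ext j
  rw [← h]
  rcases eq_or_ne j i with rfl | hj
  · simp
  · rw [Finsupp.single_eq_of_ne hj]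
    have h1 : (Finsupp.single i (m i)).degree + (m.erase i).degree = m.degree := by
      rw [← map_add, Finsupp.single_add_erase]
    rw [Finsupp.degree_single, h] at h1
    have h2 : m.erase i = 0 := by
      rw [← Finsupp.degree_eq_zero_iff]
      omega
    simpa [hj] using DFunLike.congr_fun h2 j

/-- Modulo an ideal generated by polynomials that do not involve `x_i`, a form containing a pure
power of `x_i` is a polynomial in `x_i` with unit leading coefficient. -/
lemma mem_of_mul_mem_of_coeff_single_ne_zero {i : τ} {s : Set (MvPolynomial τ k)}
    (hs : ∀ p ∈ s, p ∈ supported k {i}ᶜ) {f : MvPolynomial τ k} {a : ℕ} (hf : f.IsHomogeneous a)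
    (hfa : coeff (Finsupp.single i a) f ≠ 0) {g : MvPolynomial τ k}
    (hfg : f * g ∈ Ideal.span s) : g ∈ Ideal.span s := by
  classical
  set I := Ideal.span s
  let A := MvPolynomial τ k ⧸ I
  let π : MvPolynomial τ k →ₐ[k] A := Ideal.Quotient.mkₐ k I
  -- separate the variable `x_i` from the others, which are only kept modulo `I`
  let θ : MvPolynomial τ k →ₐ[k] Polynomial A :=
    aeval fun j => if j = i then Polynomial.X else Polynomial.C (π (X j))
  have hθ : ∀ p, (θ p).eval (π (X i)) = π p := by
    intro p
    have : ((Polynomial.aeval (π (X i))).restrictScalars k).comp θ = π := by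
      refine algHom_ext fun j => ?_
      by_cases hj : j = i <;> simp [θ, hj]
    rw [← DFunLike.congr_fun this p]
    change _ = Polynomial.aeval (π (X i)) (θ p)
    rw [Polynomial.coe_aeval_eq_eval]
  have hθs : ∀ p ∈ supported k {i}ᶜ, θ p = Polynomial.C (π p) := by
    intro p hp
    rw [supported_eq_adjoin_X] at hp
    induction hp using Algebra.adjoin_induction with
    | mem x hx =>
      obtain ⟨j, hj, rfl⟩ := hx
      have hj' : j ≠ i := hj
      simp [θ, hj']
    | algebraMap r => rw [AlgHom.commutes, AlgHom.commutes]; rfl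
    | add x y _ _ hx hy => rw [map_add, hx, hy, map_add, map_add]
    | mul x y _ _ hx hy => rw [map_mul, hx, hy, map_mul, map_mul]
  have hθI : ∀ p ∈ I, θ p = 0 := by
    intro p hp
    have : I ≤ RingHom.ker θ.toRingHom := by
      refine Ideal.span_le.2 fun q hq => ?_
      have h1 : π q = 0 := Ideal.Quotient.eq_zero_iff_mem.2 (Ideal.subset_span hq)
      have h2 := hθs q (hs q hq)
      rw [h1, Polynomial.C_0] at h2
      exact h2
    exact this hp
  set c := coeff (Finsupp.single i a) f with hc
  have hmon : (Polynomial.C (algebraMap k A c⁻¹) * θ f).Monic := by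
    have h1 : f = monomial (Finsupp.single i a) c +
        ∑ m ∈ f.support.erase (Finsupp.single i a), monomial m (coeff m f) := by
      conv_lhs => rw [f.as_sum]
      exact (Finset.add_sum_erase _ (fun m => monomial m (coeff m f))
        (mem_support_iff.2 hfa)).symm
    rw [h1, map_add, mul_add]
    have h2 : Polynomial.C (algebraMap k A c⁻¹) * θ (monomial (Finsupp.single i a) c) =
        Polynomial.X ^ a := by
      rw [← C_mul_X_pow_eq_monomial, map_mul, map_pow, ← algebraMap_eq, AlgHom.commutes,
        ← mul_assoc, show algebraMap k (Polynomial A) c = Polynomial.C (algebraMap k A c) from rfl,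
        ← Polynomial.C_mul, ← map_mul, inv_mul_cancel₀ hfa]
      simp [θ]
    rw [h2]
    refine Polynomial.monic_X_pow_add ?_
    rw [map_sum, Finset.mul_sum]
    refine (Polynomial.degree_sum_le _ _).trans_lt ?_
    rw [Finset.sup_lt_iff (by exact WithBot.bot_lt_coe a)]
    intro m hm
    obtain ⟨hma, hmf⟩ := Finset.mem_erase.1 hm
    have hdeg : m.degree = a := by
      by_contra h
      exact mem_support_iff.1 hmf (hf.coeff_eq_zero h)
    have hmi : m i < a := hdeg ▸ apply_lt_of_degree_eq (hdeg.symm ▸ hma)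
    have h4 : θ (monomial (m.erase i) (coeff m f)) =
        Polynomial.C (π (monomial (m.erase i) (coeff m f))) := by
      refine hθs _ ?_
      rw [mem_supported]
      intro j hj
      rw [vars_monomial (mem_support_iff.1 hmf)] at hj
      have : j ≠ i := fun h => by simp [h] at hj
      exact this
    have h5 : monomial m (coeff m f) =
        X i ^ (m i) * monomial (m.erase i) (coeff m f) := by
      rw [X_pow_eq_monomial, monomial_mul, one_mul, Finsupp.single_add_erase]
    rw [h5, map_mul, map_pow, h4]
    have h6 : θ (X i) = Polynomial.X := by simp [θ]
    have h7 : ∀ u v : A, Polynomial.C u * (Polynomial.X ^ m i * Polynomial.C v) =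
        Polynomial.C (u * v) * Polynomial.X ^ m i := fun u v => by
      rw [Polynomial.C_mul]
      ring
    rw [h6]
    refine (congrArg Polynomial.degree (h7 _ _)).trans_lt ?_
    refine (Polynomial.degree_C_mul_X_pow_le _ _).trans_lt ?_
    exact_mod_cast hmi
  have h0 : θ f * θ g = 0 := by rw [← map_mul]; exact hθI _ hfg
  have h1 : θ g = 0 := by
    refine (hmon.mul_right_eq_zero_iff).1 ?_
    rw [mul_assoc, h0, mul_zero]
  have h2 : π g = 0 := by rw [← hθ g, h1, Polynomial.eval_zero]
  exact Ideal.Quotient.eq_zero_iff_mem.1 h2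

lemma ofList_take_ofFn {R : Type*} [CommRing R] {r : ℕ} (f : Fin r → R) (i : ℕ) :
    Ideal.ofList ((List.ofFn f).take i) = Ideal.span {p | ∃ j : Fin r, j.1 < i ∧ f j = p} := by
  rw [Ideal.ofList]
  congr 1
  ext p
  rw [Set.mem_ofPred_eq, Set.mem_ofPred_eq, List.mem_take_iff_getElem]
  constructor
  · rintro ⟨j, hj, rfl⟩
    rw [List.length_ofFn] at hj
    exact ⟨⟨j, (lt_min_iff.1 hj).2⟩, (lt_min_iff.1 hj).1, by simp⟩
  · rintro ⟨j, hj, rfl⟩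
    exact ⟨j, by simp [hj], by simp⟩

/-- A triangular system of forms, the `i`-th of which contains a pure power of the new variable
`x_i`, is a regular sequence. -/
lemma isRegular_of_triangular {n r : ℕ} (hr : r ≤ n + 1) {a : Fin r → ℕ} (ha : ∀ i, a i ≠ 0)
    {f : Fin r → MvPolynomial (Fin (n + 1)) k} (hf : ∀ i, (f i).IsHomogeneous (a i))
    (hsupp : ∀ i, f i ∈ supported k {j : Fin (n + 1) | j.1 ≤ i.1 ∨ r ≤ j.1})
    (hcoeff : ∀ i, coeff (Finsupp.single (Fin.castLE hr i) (a i)) (f i) ≠ 0) :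
    RingTheory.Sequence.IsRegular (MvPolynomial (Fin (n + 1)) k) (List.ofFn f) := by
  refine ⟨?_, ?_⟩
  · rw [RingTheory.Sequence.isWeaklyRegular_iff_Fin]
    intro i
    obtain ⟨i, hi⟩ := i
    have hi' : i < r := by simpa using hi
    rw [isSMulRegular_quotient_iff_mem_of_smul_mem]
    intro g hg
    rw [smul_eq_mul, Ideal.mul_top, ofList_take_ofFn] at hg ⊢
    refine mem_of_mul_mem_of_coeff_single_ne_zero (i := Fin.castLE hr ⟨i, hi'⟩)
      (f := f ⟨i, hi'⟩) ?_ (hf _) (hcoeff _) (by simpa using hg)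
    rintro _ ⟨j, hj, rfl⟩
    refine supported_mono ?_ (hsupp j)
    rintro l (hl | hl) (rfl : l = _)
    · simp at hl hj; omega
    · simp at hl; omega
  · intro h
    have h1 : Ideal.ofList (List.ofFn f) ≤ RingHom.ker (constantCoeff (R := k)) := by
      refine Ideal.span_le.2 ?_
      rintro p hp
      obtain ⟨i, rfl⟩ : ∃ i, f i = p := by simpa using hp
      refine (hf i).coeff_eq_zero ?_
      rw [map_zero]
      exact (ha i).symm
    rw [smul_eq_mul, Ideal.mul_top] at h
    rw [← h] at h1
    have h2 : (1 : MvPolynomial (Fin (n + 1)) k) ∈ RingHom.ker (constantCoeff (R := k)) :=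
      h1 trivial
    simp at h2

end RegularSequences

/-! ### The generic form as a sum of products -/

section GenericForm

open MvPolynomial

/-- Monomials of degree `d`, as multisets of variables and as exponent vectors. -/
noncomputable def symEquivExponent (τ : Type*) [DecidableEq τ] (d : ℕ) :
    Sym τ d ≃ {m : τ →₀ ℕ // m.degree = d} :=
  Multiset.toFinsupp.toEquiv.subtypeEquiv fun s => by
    rw [← Multiset.toFinsupp_sum_eq]
    rfl

lemma symEquivExponent_cons {τ : Type*} [DecidableEq τ] {d : ℕ} (k : τ) (β : Sym τ d) :
    (symEquivExponent τ (d + 1) (k ::ₛ β)).1 =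
      Finsupp.single k 1 + (symEquivExponent τ d β).1 := by
  change Multiset.toFinsupp (k ::ₘ β.1) = _ + Multiset.toFinsupp β.1
  rw [← Multiset.singleton_add, map_add, Multiset.toFinsupp_singleton]

noncomputable instance {τ : Type*} [Finite τ] (d : ℕ) : Fintype {m : τ →₀ ℕ // m.degree = d} :=
  (Finsupp.finite_of_degree_eq d).fintype

lemma monomial_symEquivExponent_cons {τ R : Type*} [DecidableEq τ] [CommSemiring R] {d : ℕ}
    (k : τ) (β : Sym τ d) (a b : R) : C a * X k * monomial (symEquivExponent τ d β).1 b =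
      monomial (symEquivExponent τ (d + 1) (k ::ₛ β)).1 (a * b) := by
  rw [C_mul_X_eq_monomial, monomial_mul, symEquivExponent_cons]

variable {R : Type*} [CommRing R] {n r e : ℕ}

/-- Indices for the coefficients of `r` linear forms and `r` forms of degree `e`. -/
abbrev EchelonIndex (n r e : ℕ) : Type :=
  (Fin r × Fin (n + 1)) ⊕ (Fin r × Sym (Fin (n + 1)) e)

/-- The linear form `x_i + ∑_{k ≥ r} ℓ_{ik} x_k`. -/
noncomputable def echelonForm (hr : r ≤ n + 1) (l : Fin r × Fin (n + 1) → R) (i : Fin r) :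
    MvPolynomial (Fin (n + 1)) R :=
  C 1 * X (Fin.castLE hr i) + ∑ k : Fin (n + 1) with r ≤ k.1, C (l (i, k)) * X k

/-- The form of degree `e` in the variables `x_0, …, x_i` and `x_r, …, x_n` with coefficients
`g (i, ·)`. -/
noncomputable def cofactorForm (g : Fin r × Sym (Fin (n + 1)) e → R) (i : Fin r) :
    MvPolynomial (Fin (n + 1)) R :=
  ∑ β : Sym (Fin (n + 1)) e with ∀ k ∈ β.1, k.1 ≤ i.1 ∨ r ≤ k.1,
    monomial (symEquivExponent _ e β).1 (g (i, β))

lemma isHomogeneous_echelonForm (hr : r ≤ n + 1) (l : Fin r × Fin (n + 1) → R) (i : Fin r) :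
    (echelonForm hr l i).IsHomogeneous 1 :=
  (isHomogeneous_C_mul_X _ _).add (IsHomogeneous.sum _ _ _ fun _ _ => isHomogeneous_C_mul_X _ _)

lemma isHomogeneous_cofactorForm (g : Fin r × Sym (Fin (n + 1)) e → R) (i : Fin r) :
    (cofactorForm g i).IsHomogeneous e :=
  IsHomogeneous.sum _ _ _ fun β _ => isHomogeneous_monomial _ (symEquivExponent _ e β).2

lemma echelonForm_mem_supported (hr : r ≤ n + 1) (l : Fin r × Fin (n + 1) → R) (i : Fin r) :
    echelonForm hr l i ∈ supported R {j : Fin (n + 1) | j.1 ≤ i.1 ∨ r ≤ j.1} := by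
  have hX : ∀ (c : R) (k : Fin (n + 1)), (k.1 ≤ i.1 ∨ r ≤ k.1) →
      C c * X k ∈ supported R {j : Fin (n + 1) | j.1 ≤ i.1 ∨ r ≤ j.1} := fun c k hk =>
    mul_mem (Subalgebra.algebraMap_mem _ c) (Algebra.subset_adjoin ⟨k, hk, rfl⟩)
  refine add_mem (hX _ _ (Or.inl (by simp))) (sum_mem fun k hk => hX _ _ (Or.inr ?_))
  simpa using hk

lemma cofactorForm_mem_supported (g : Fin r × Sym (Fin (n + 1)) e → R) (i : Fin r) :
    cofactorForm g i ∈ supported R {j : Fin (n + 1) | j.1 ≤ i.1 ∨ r ≤ j.1} := by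
  refine sum_mem fun β hβ => ?_
  rw [mem_supported]
  intro j hj
  by_cases h0 : g (i, β) = 0
  · simp [h0] at hj
  rw [vars_monomial h0] at hj
  have h2 : j ∈ β := by
    have : j ∈ (Multiset.toFinsupp β.1).support := hj
    simpa using this
  exact (Finset.mem_filter.1 hβ).2 j h2

lemma coeff_echelonForm (hr : r ≤ n + 1) (l : Fin r × Fin (n + 1) → R) (i : Fin r) :
    coeff (Finsupp.single (Fin.castLE hr i) 1) (echelonForm hr l i) = 1 := by
  rw [echelonForm, coeff_add, coeff_sum, Finset.sum_eq_zero, add_zero]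
  · simp
  · intro k hk
    have h1 : r ≤ k.1 := by simpa using hk
    have h2 : k ≠ Fin.castLE hr i := by
      rintro rfl
      simp at h1
      omega
    simp [coeff_C_mul, coeff_X, Finsupp.single_left_inj, h2]

lemma coeff_cofactorForm (hr : r ≤ n + 1) (g : Fin r × Sym (Fin (n + 1)) e → R) (i : Fin r) :
    coeff (Finsupp.single (Fin.castLE hr i) e) (cofactorForm g i) =
      g (i, Sym.replicate e (Fin.castLE hr i)) := by
  have h1 : Finsupp.single (Fin.castLE hr i) e =
      (symEquivExponent _ e (Sym.replicate e (Fin.castLE hr i))).1 := by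
    change _ = Multiset.toFinsupp (Multiset.replicate e _)
    rw [← Multiset.nsmul_singleton, map_nsmul, Multiset.toFinsupp_singleton]
    simp
  rw [cofactorForm, coeff_sum, h1, Finset.sum_eq_single (Sym.replicate e (Fin.castLE hr i))]
  · simp
  · intro β _ hβ
    rw [coeff_monomial, if_neg]
    exact fun h => hβ ((symEquivExponent _ e).injective (Subtype.ext h))
  · intro h
    exfalso
    apply h
    refine Finset.mem_filter.2 ⟨Finset.mem_univ _, fun k hk => Or.inl ?_⟩
    rw [(Sym.mem_replicate.1 hk).2]
    simp

/-- The sum `∑ i, L_i G_i` for the forms `L_i`, `G_i` with given coefficients. -/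
noncomputable def echelonSum (e : ℕ) (hr : r ≤ n + 1)
    (z : EchelonIndex n r e → R) :
    MvPolynomial (Fin (n + 1)) R :=
  ∑ i, echelonForm hr (z ∘ Sum.inl) i * cofactorForm (z ∘ Sum.inr) i

lemma isHomogeneous_echelonSum (hr : r ≤ n + 1)
    (z : EchelonIndex n r e → R) :
    (echelonSum e hr z).IsHomogeneous (e + 1) :=
  IsHomogeneous.sum _ _ _ fun i _ => by
    rw [add_comm e 1]
    exact (isHomogeneous_echelonForm hr _ i).mul (isHomogeneous_cofactorForm _ i)

lemma map_echelonSum {R' : Type*} [CommRing R'] (φ : R →+* R') (hr : r ≤ n + 1)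
    (z : EchelonIndex n r e → R) :
    map φ (echelonSum e hr z) = echelonSum e hr (φ ∘ z) := by
  simp [echelonSum, echelonForm, cofactorForm, map_sum]

lemma echelonSum_eq (hr : r ≤ n + 1)
    (z : EchelonIndex n r e → R) :
    echelonSum e hr z = ∑ i : Fin r,
      ∑ β : Sym (Fin (n + 1)) e with ∀ k ∈ β.1, k.1 ≤ i.1 ∨ r ≤ k.1,
        (monomial (symEquivExponent _ (e + 1) (Fin.castLE hr i ::ₛ β)).1 (z (Sum.inr (i, β))) +
          ∑ k : Fin (n + 1) with r ≤ k.1, monomial (symEquivExponent _ (e + 1) (k ::ₛ β)).1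
            (z (Sum.inl (i, k)) * z (Sum.inr (i, β)))) := by
  refine Finset.sum_congr rfl fun i _ => ?_
  rw [cofactorForm, Finset.mul_sum]
  refine Finset.sum_congr rfl fun β _ => ?_
  rw [echelonForm, add_mul, Finset.sum_mul]
  simp only [monomial_symEquivExponent_cons, one_mul, Function.comp]

/-- At the point where all `L_i` are variables and the `G_i` are forms in the last `n + 1 - r`
variables as in `exists_pairWith_injective`, the differential of `echelonSum` is surjective. -/
lemma aeval_echelonSum_injective (he : 2 ≤ e) (hr : r ≤ n)
    (h : (n - r + (e + 1)).choose (e + 1) ≤ (n - r + 1) * r) :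
    Function.Injective (aeval (R := ℂ)
      fun m : {m : Fin (n + 1) →₀ ℕ // m.degree = e + 1} =>
        coeff m.1 (echelonSum e (hr.trans n.le_succ)
          (X : _ → MvPolynomial (EchelonIndex n r e) ℂ))) := by
  let σ := {k : Fin (n + 1) // r ≤ k.1}
  have hσ : Fintype.card σ = n - r + 1 := by
    rw [Fintype.card_subtype]
    have : (Finset.univ.filter fun k : Fin (n + 1) => r ≤ k.1) =
        Finset.Ici (⟨r, by omega⟩ : Fin (n + 1)) := by
      ext k; simp [Fin.le_def]
    rw [this, Fin.card_Ici]
    simp; omega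
  have : Nonempty σ := ⟨⟨⟨r, by omega⟩, le_rfl⟩⟩
  obtain ⟨G, hG⟩ := exists_pairWith_injective (k := ℂ) (σ := σ) (r := r) he
    (by rw [hσ, show n - r + 1 + e = n - r + (e + 1) by ring]; exact h)
  let ι : ∀ d, Sym σ d → Sym (Fin (n + 1)) d := fun d => Sym.map Subtype.val
  have hι : ∀ d, Function.Injective (ι d) := fun d => Sym.map_injective Subtype.val_injective d
  let z : EchelonIndex n r e → ℂ :=
    Sum.elim 0 fun p => Function.extend (ι e) (G p.1) 0 p.2
  refine aeval_injective_of_jacobian _ z fun v hv => ?_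
  let w : Sym (Fin (n + 1)) (e + 1) → ℂ := fun s => v (symEquivExponent _ _ s)
  let ζ := EchelonIndex n r e
  let T : MvPolynomial (Fin (n + 1)) (MvPolynomial ζ ℂ) →ₗ[MvPolynomial ζ ℂ] MvPolynomial ζ ℂ :=
    ∑ m : {m : Fin (n + 1) →₀ ℕ // m.degree = e + 1}, (C (v m) : MvPolynomial ζ ℂ) • lcoeff _ m.1
  have hT : ∀ s a, T (monomial (symEquivExponent _ (e + 1) s).1 a) = C (w s) * a := by
    intro s a
    simp only [T, LinearMap.sum_apply, LinearMap.smul_apply, lcoeff_apply, coeff_monomial,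
      smul_eq_mul]
    rw [Finset.sum_eq_single (symEquivExponent _ (e + 1) s)]
    · simp [w]
    · intro m _ hm
      rw [if_neg fun h => hm (Subtype.ext h.symm), mul_zero]
    · simp
  have hTF : ∀ j, eval z (pderiv j (T (echelonSum e (hr.trans n.le_succ) X))) = 0 := by
    intro j
    rw [← hv j]
    simp [T]
  rw [echelonSum_eq] at hTF
  simp only [map_sum, map_add, hT, Derivation.leibniz, smul_eq_mul, map_mul, pderiv_C,
    mul_zero, add_zero, eval_X, eval_C] at hTF
  -- varying the coefficients of the `G_i`
  have h1 : ∀ (i : Fin r) (β : Sym (Fin (n + 1)) e), (∀ k ∈ β, k.1 ≤ i.1 ∨ r ≤ k.1) →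
      w (Fin.castLE (hr.trans n.le_succ) i ::ₛ β) = 0 := by
    intro i β hβ
    have h2 := hTF (Sum.inr (i, β))
    simp only [pderiv_X, Pi.single_apply, Sum.inr.injEq, Prod.mk.injEq, Sum.elim_inl, z,
      Pi.zero_apply, reduceCtorEq, if_false, map_zero, mul_zero, ite_self, add_zero,
      Finset.sum_const_zero, apply_ite (eval _), map_one, mul_ite, mul_one] at h2
    rwa [Finset.sum_eq_single i, Finset.sum_eq_single β, if_pos ⟨rfl, rfl⟩] at h2
    · exact fun γ _ hγ => if_neg fun h => hγ h.2
    · exact fun h => absurd (Finset.mem_filter.2 ⟨Finset.mem_univ _, hβ⟩) h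
    · exact fun j _ hj => Finset.sum_eq_zero fun γ _ => if_neg fun h => hj h.1
    · simp
  -- varying the coefficients of the `L_i`
  have h2 : ∀ (i : Fin r) (k : σ), ∑ γ, G i γ * w (k.1 ::ₛ ι e γ) = 0 := by
    intro i k
    have h2 := hTF (Sum.inl (i, k.1))
    simp only [pderiv_X, Pi.single_apply, Sum.inl.injEq, Prod.mk.injEq, Sum.elim_inr, z,
      reduceCtorEq, if_false, map_zero, mul_zero, zero_add, apply_ite (eval _), map_one, mul_ite,
      mul_one] at h2
    rw [Finset.sum_eq_single i] at h2
    · have h3 : ∀ β : Sym (Fin (n + 1)) e, ∑ k' : Fin (n + 1) with r ≤ k'.1,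
          (if i = i ∧ k' = k.1 then w (k' ::ₛ β) * Function.extend (ι e) (G i) 0 β else 0) =
          w (k.1 ::ₛ β) * Function.extend (ι e) (G i) 0 β := by
        intro β
        rw [Finset.sum_eq_single k.1, if_pos ⟨rfl, rfl⟩]
        · exact fun k' _ hk' => if_neg fun h => hk' h.2
        · exact fun h => (h (by simpa using k.2)).elim
      rw [Finset.sum_congr rfl fun β _ => h3 β] at h2
      rw [← h2]
      refine Finset.sum_of_injOn (ι e) (hι e).injOn ?_ ?_ ?_
      · intro γ _
        refine Finset.mem_filter.2 ⟨Finset.mem_univ _, fun k hk => Or.inr ?_⟩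
        obtain ⟨k', -, rfl⟩ := Multiset.mem_map.1 hk
        exact k'.2
      · intro β _ hβ
        rw [Function.extend_apply' _ _ _ fun ⟨γ, hγ⟩ => hβ ⟨γ, by simp, hγ⟩, Pi.zero_apply,
          mul_zero]
      · intro γ _
        rw [(hι e).extend_apply, mul_comm]
    · exact fun j _ hj => Finset.sum_eq_zero fun γ _ => Finset.sum_eq_zero fun _ _ =>
        if_neg fun h => hj h.1
    · simp
  have h3 : ∀ s : Sym σ (e + 1), w (ι _ s) = 0 := by
    refine congrFun (hG (fun s => w (ι _ s)) ?_)
    ext i k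
    simpa [pairWith, ι, Sym.map_cons] using h2 i k
  ext m
  obtain ⟨s, rfl⟩ := (symEquivExponent _ (e + 1)).surjective m
  change w s = 0
  by_cases hs : ∃ k ∈ s, k.1 < r
  · -- split off the variable with the largest index below `r`
    obtain ⟨k, hk, hmax⟩ := (s.1.toFinset.filter fun k => k.1 < r).exists_max_image id
      (by obtain ⟨k, hk, hkr⟩ := hs
          exact ⟨k, Finset.mem_filter.2 ⟨Multiset.mem_toFinset.2 hk, hkr⟩⟩)
    obtain ⟨hks, hkr⟩ := Finset.mem_filter.1 hk
    obtain ⟨β, rfl⟩ := Sym.exists_cons_of_mem (Multiset.mem_toFinset.1 hks)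
    refine h1 ⟨k, hkr⟩ β fun j hj => ?_
    by_contra! hcon
    exact absurd (hmax j (Finset.mem_filter.2
      ⟨Multiset.mem_toFinset.2 (Sym.mem_cons_of_mem hj), hcon.2⟩)) (not_le.2 hcon.1)
  · push Not at hs
    rw [← h3 (s.attach.map fun k => ⟨k.1, hs k.1 k.2⟩)]
    simp only [ι, Sym.map_map]
    congr 1
    exact s.attach_map_coe.symm

/-- If the binomial inequality holds, a generic form of degree `e + 1` is a sum `∑ i, L_i G_i` in
which each `G_i` contains the pure power `x_i ^ e`. -/
lemma exists_echelonSum_eq_of_generic (he : 2 ≤ e) (hr : r ≤ n)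
    (h : (n - r + (e + 1)).choose (e + 1) ≤ (n - r + 1) * r) :
    ∃ Φ : MvPolynomial {m : Fin (n + 1) →₀ ℕ // m.degree = e + 1} ℂ, Φ ≠ 0 ∧
      ∀ F : MvPolynomial (Fin (n + 1)) ℂ, F.IsHomogeneous (e + 1) →
        eval (fun m => coeff m.1 F) Φ ≠ 0 →
        ∃ z : EchelonIndex n r e → ℂ, F = echelonSum e (hr.trans n.le_succ) z ∧
          ∀ i, z (Sum.inr (i, Sym.replicate e (Fin.castLE (hr.trans n.le_succ) i))) ≠ 0 := by
  have hr' := hr.trans n.le_succ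
  obtain ⟨Φ, hΦ, hz⟩ := exists_forall_eval_ne_zero_imp_mem_image _
    (aeval_echelonSum_injective he hr h)
    (b := ∏ i : Fin r, X (Sum.inr (i, Sym.replicate e (Fin.castLE hr' i))))
    (Finset.prod_ne_zero_iff.2 fun i _ => X_ne_zero _)
  refine ⟨Φ, hΦ, fun F hF hFΦ => ?_⟩
  obtain ⟨z, hz1, hz2⟩ := hz _ hFΦ
  refine ⟨z, ?_, fun i => ?_⟩
  · ext m
    by_cases hm : m.degree = e + 1
    · rw [← hz1 ⟨m, hm⟩]
      have h1 : map (eval z) (echelonSum e hr' X) = echelonSum e hr' z := by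
        rw [map_echelonSum]
        congr 1
        ext j
        simp
      rw [← h1, coeff_map]
    · rw [hF.coeff_eq_zero hm, (isHomogeneous_echelonSum _ z).coeff_eq_zero hm]
  · rw [map_prod] at hz2
    simpa using Finset.prod_ne_zero_iff.1 hz2 i (Finset.mem_univ _)

/-- The linear forms and their cofactors can be exchanged: both triangular systems consist of forms
containing a pure power of the new variable, so every choice of one of `L_i`, `G_i` for each `i`
is a regular sequence. -/
lemma containsCI_echelonSum (he : 2 ≤ e) (hr : r ≤ n) {a : Fin r → ℕ}
    (ha : ∀ i, a i = 1 ∨ a i = e) (z : EchelonIndex n r e → ℂ)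
    (hz : ∀ i, z (Sum.inr (i, Sym.replicate e (Fin.castLE (hr.trans n.le_succ) i))) ≠ 0) :
    ContainsCI a (echelonSum e (hr.trans n.le_succ) z) := by
  have hr' := hr.trans n.le_succ
  let f : Fin r → CoordRing n := fun i =>
    if a i = 1 then echelonForm hr' (z ∘ Sum.inl) i else cofactorForm (z ∘ Sum.inr) i
  have hf1 : ∀ i, a i = 1 → f i = echelonForm hr' (z ∘ Sum.inl) i := fun i hi => if_pos hi
  have hf2 : ∀ i, a i = e → f i = cofactorForm (z ∘ Sum.inr) i := fun i hi =>
    if_neg (by omega)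
  have hom : ∀ i, (f i).IsHomogeneous (a i) := by
    intro i
    rcases ha i with hi | hi
    · rw [hf1 i hi, hi]
      exact isHomogeneous_echelonForm _ _ _
    · rw [hf2 i hi, hi]
      exact isHomogeneous_cofactorForm _ _
  refine ⟨_, ⟨f, hom, ?_, rfl⟩, ?_⟩
  · refine isRegular_of_triangular hr' (fun i => by have := ha i; omega) hom (fun i => ?_)
      fun i => ?_
    · rcases ha i with hi | hi
      · rw [hf1 i hi]
        exact echelonForm_mem_supported _ _ _
      · rw [hf2 i hi]
        exact cofactorForm_mem_supported _ _
    · rcases ha i with hi | hi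
      · rw [hf1 i hi, hi, coeff_echelonForm]
        exact one_ne_zero
      · rw [hf2 i hi, hi, coeff_cofactorForm]
        exact hz i
  · rw [Ideal.span_singleton_le_iff_mem]
    refine Ideal.sum_mem _ fun i _ => ?_
    have hfi : f i ∈ Ideal.span (Set.range f) := Ideal.subset_span ⟨i, rfl⟩
    rcases ha i with hi | hi
    · exact Ideal.mul_mem_right _ _ (hf1 i hi ▸ hfi)
    · exact Ideal.mul_mem_left _ _ (hf2 i hi ▸ hfi)

end GenericForm

/-! ### Planes and complete intersections -/

section Planes

open MvPolynomial

variable {n r : ℕ}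

lemma homogeneousComponent_mul_of_isHomogeneous {σ R : Type*} [CommRing R] {d a : ℕ}
    (had : a ≤ d) (p : MvPolynomial σ R) {q : MvPolynomial σ R} (hq : q.IsHomogeneous a) :
    homogeneousComponent d (p * q) = homogeneousComponent (d - a) p * q := by
  conv_lhs => rw [← sum_homogeneousComponent p, Finset.sum_mul, map_sum]
  have h1 : ∀ k, homogeneousComponent d (homogeneousComponent k p * q) =
      if k = d - a then homogeneousComponent (d - a) p * q else 0 := by
    intro k
    rw [homogeneousComponent_of_mem ((homogeneousComponent_isHomogeneous k p).mul hq)]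
    split_ifs with h2 h3 h3
    · rw [h3]
    · omega
    · omega
    · rfl
  simp only [h1]
  rw [Finset.sum_ite_eq']
  split_ifs with h2
  · rfl
  · rw [homogeneousComponent_eq_zero _ _ (by simp at h2; omega), zero_mul]

/-- A form of degree `e + 1` in an ideal generated by forms of degrees `1` and `e` lies in an
ideal generated by as many linear forms, which are possibly zero. -/
lemma exists_linear_forms_of_containsCI {e : ℕ} {a : Fin r → ℕ} (ha : ∀ i, a i = 1 ∨ a i = e)
    {F : CoordRing n} (hF : F.IsHomogeneous (e + 1)) (h : ContainsCI a F) :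
    ∃ M : Fin r → CoordRing n, (∀ i, (M i).IsHomogeneous 1) ∧ F ∈ Ideal.span (Set.range M) := by
  obtain ⟨I, ⟨f, hf, -, rfl⟩, hFI⟩ := h
  rw [Ideal.span_singleton_le_iff_mem, Ideal.mem_span_range_iff_exists_fun] at hFI
  obtain ⟨c, hc⟩ := hFI
  have hai : ∀ i, a i ≤ e + 1 := fun i => by have := ha i; omega
  have h1 : F = ∑ i, homogeneousComponent (e + 1 - a i) (c i) * f i := by
    rw [← homogeneousComponent_eq_self hF, ← hc, map_sum]
    exact Finset.sum_congr rfl fun i _ => homogeneousComponent_mul_of_isHomogeneous (hai i) _ (hf i)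
  let M : Fin r → CoordRing n := fun i =>
    if a i = 1 then f i else homogeneousComponent (e + 1 - a i) (c i)
  refine ⟨M, fun i => ?_, ?_⟩
  · by_cases hi : a i = 1
    · have := hf i
      rw [hi] at this
      simpa [M, hi] using this
    · have h2 : e + 1 - a i = 1 := by have := ha i; omega
      simp only [M, if_neg hi, h2]
      exact homogeneousComponent_isHomogeneous _ _
  · rw [h1]
    refine Ideal.sum_mem _ fun i _ => ?_
    have hM : M i ∈ Ideal.span (Set.range M) := Ideal.subset_span ⟨i, rfl⟩
    by_cases hi : a i = 1
    · simp only [M, if_pos hi] at hM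
      exact Ideal.mul_mem_left _ _ hM
    · simp only [M, if_neg hi] at hM
      exact Ideal.mul_mem_right _ _ hM

lemma exists_dual_eval_eq {M : CoordRing n} (hM : M.IsHomogeneous 1) :
    ∃ φ : Dual ℂ (Fin (n + 1) → ℂ), ∀ v, eval v M = φ v := by
  have h1 : M ∈ Submodule.span ℂ (Set.range (X : Fin (n + 1) → CoordRing n)) := by
    rw [← homogeneousSubmodule_one_eq_span_X]
    exact hM
  clear hM
  induction h1 using Submodule.span_induction with
  | mem x hx => obtain ⟨i, rfl⟩ := hx; exact ⟨LinearMap.proj i, by simp⟩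
  | zero => exact ⟨0, by simp⟩
  | add x y _ _ hx hy =>
    obtain ⟨φ, hφ⟩ := hx
    obtain ⟨ψ, hψ⟩ := hy
    exact ⟨φ + ψ, fun v => by simp [hφ, hψ]⟩
  | smul c x _ hx =>
    obtain ⟨φ, hφ⟩ := hx
    exact ⟨c • φ, fun v => by simp [smul_eval, hφ]⟩

/-- `r` linear forms have at least an `(n - r)`-plane of common zeros. -/
lemma fanoVariety_nonempty_of_mem_span (hr : r ≤ n) {F : CoordRing n} {M : Fin r → CoordRing n}
    (hM : ∀ i, (M i).IsHomogeneous 1) (hF : F ∈ Ideal.span (Set.range M)) :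
    (fanoVariety (n - r) F).Nonempty := by
  choose φ hφ using fun i => exists_dual_eval_eq (hM i)
  let L : (Fin (n + 1) → ℂ) →ₗ[ℂ] (Fin r → ℂ) := LinearMap.pi φ
  have h1 : n - r + 1 ≤ finrank ℂ L.ker := by
    have h2 := L.finrank_range_add_finrank_ker
    have h3 := Submodule.finrank_le L.range
    rw [finrank_fintype_fun_eq_card, Fintype.card_fin] at h2 h3
    omega
  obtain ⟨f, hf⟩ := exists_linearIndependent_of_le_finrank h1
  refine ⟨(Submodule.span ℂ (Set.range f)).map L.ker.subtype, ?_, ?_⟩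
  · rw [LinearEquiv.finrank_eq (Submodule.equivMapOfInjective _ L.ker.subtype_injective _).symm,
      finrank_span_eq_card hf, Fintype.card_fin]
  · rintro _ ⟨v, -, rfl⟩
    have h2 : Ideal.span (Set.range M) ≤ RingHom.ker (eval (v : Fin (n + 1) → ℂ)) := by
      refine Ideal.span_le.2 ?_
      rintro _ ⟨i, rfl⟩
      change eval _ _ = 0
      rw [hφ]
      exact congrFun v.2 i
    exact h2 hF

/-- The algebra endomorphism of the coordinate ring that composes a polynomial with a linear
endomorphism of the affine space. -/
noncomputable def linearSubst (g : (Fin (n + 1) → ℂ) →ₗ[ℂ] (Fin (n + 1) → ℂ)) :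
    CoordRing n →ₐ[ℂ] CoordRing n :=
  aeval fun j => ∑ i, C (g (Pi.single i 1) j) * X i

lemma eval_linearSubst (g : (Fin (n + 1) → ℂ) →ₗ[ℂ] (Fin (n + 1) → ℂ)) (v : Fin (n + 1) → ℂ)
    (p : CoordRing n) : eval v (linearSubst g p) = eval (g v) p := by
  have h1 : ((aeval v : CoordRing n →ₐ[ℂ] ℂ).comp (linearSubst g)) = aeval (g v) := by
    refine algHom_ext fun j => ?_
    have h2 : g v = ∑ i, v i • g (Pi.single i 1) := by
      conv_lhs => rw [← Finset.univ_sum_single v]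
      rw [map_sum]
      refine Finset.sum_congr rfl fun i _ => ?_
      rw [← map_smul, ← Pi.single_smul, smul_eq_mul, mul_one]
    simp [linearSubst, h2, mul_comm]
  exact DFunLike.congr_fun h1 p

/-- A linear change of coordinates. -/
noncomputable def linearSubstEquiv (g : (Fin (n + 1) → ℂ) ≃ₗ[ℂ] (Fin (n + 1) → ℂ)) :
    CoordRing n ≃ₐ[ℂ] CoordRing n :=
  AlgEquiv.ofAlgHom (linearSubst g) (linearSubst g.symm)
    (AlgHom.ext fun p => MvPolynomial.funext fun v => by simp [eval_linearSubst])
    (AlgHom.ext fun p => MvPolynomial.funext fun v => by simp [eval_linearSubst])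

lemma mem_span_X_of_forall_eval_eq_zero (hr : r ≤ n + 1) {p : CoordRing n}
    (h : ∀ v : Fin (n + 1) → ℂ, (∀ i : Fin r, v (Fin.castLE hr i) = 0) → eval v p = 0) :
    p ∈ Ideal.span (Set.range fun i : Fin r => (X (Fin.castLE hr i) : CoordRing n)) := by
  set I := Ideal.span (Set.range fun i : Fin r => (X (Fin.castLE hr i) : CoordRing n)) with hI
  let ρ : CoordRing n →ₐ[ℂ] CoordRing n := aeval fun j => if j.1 < r then 0 else X j
  have h0 : ρ p = 0 := by
    refine MvPolynomial.funext fun v => ?_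
    have h1 : eval v (ρ p) = eval (fun j => if j.1 < r then 0 else v j) p := by
      have : (aeval v : CoordRing n →ₐ[ℂ] ℂ).comp ρ =
          aeval fun j => if j.1 < r then 0 else v j := by
        refine algHom_ext fun j => ?_
        by_cases hj : j.1 < r <;> simp [ρ, hj]
      exact DFunLike.congr_fun this p
    rw [h1, h _ fun i => by simp, map_zero]
  have h2 : (Ideal.Quotient.mkₐ ℂ I).comp ρ = Ideal.Quotient.mkₐ ℂ I := by
    refine algHom_ext fun j => ?_
    by_cases hj : j.1 < r
    · have : (X j : CoordRing n) ∈ I := Ideal.subset_span ⟨⟨j, hj⟩, rfl⟩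
      simp [ρ, hj, (Ideal.Quotient.eq_zero_iff_mem (I := I)).2 this]
    · simp [ρ, hj]
  have h3 := DFunLike.congr_fun h2 p
  rw [AlgHom.comp_apply, h0, map_zero] at h3
  exact Ideal.Quotient.eq_zero_iff_mem.1 h3.symm

lemma exists_basis_mem (hr : r ≤ n) {W : Submodule ℂ (Fin (n + 1) → ℂ)}
    (hW : finrank ℂ W = n - r + 1) :
    ∃ b : Basis (Fin (n + 1)) ℂ (Fin (n + 1) → ℂ), ∀ j, r ≤ j.1 → b j ∈ W := by
  obtain ⟨U, hU⟩ := W.exists_isCompl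
  have h1 := Submodule.finrank_add_eq_of_isCompl hU
  rw [finrank_fintype_fun_eq_card, Fintype.card_fin, hW] at h1
  let bU : Basis (Fin r) ℂ U := finBasisOfFinrankEq ℂ U (by omega)
  let bW : Basis (Fin (n - r + 1)) ℂ W := finBasisOfFinrankEq ℂ W hW
  let b := (bU.prod bW).map (Submodule.prodEquivOfIsCompl U W hU.symm)
  let e : Fin r ⊕ Fin (n - r + 1) ≃ Fin (n + 1) := finSumFinEquiv.trans (finCongr (by omega))
  refine ⟨b.reindex e, fun j hj => ?_⟩
  obtain ⟨x, rfl⟩ := e.surjective j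
  rw [Basis.reindex_apply, e.symm_apply_apply]
  rcases x with i | i
  · simp [e] at hj
    omega
  · simp [b]

/-- In suitable coordinates the plane is `x_0 = ⋯ = x_{r - 1} = 0`. -/
lemma containsCI_one_of_mem_fanoVariety (hr : r ≤ n) {F : CoordRing n}
    {W : Submodule ℂ (Fin (n + 1) → ℂ)} (hW : W ∈ fanoVariety (n - r) F) :
    ContainsCI (fun _ : Fin r => 1) F := by
  have hr' := hr.trans n.le_succ
  obtain ⟨hdim, hFW⟩ := hW
  obtain ⟨b, hb⟩ := exists_basis_mem hr hdim
  let τ := linearSubstEquiv b.equivFun.symm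
  let x : Fin r → CoordRing n := fun i => X (Fin.castLE hr' i)
  have hx : RingTheory.Sequence.IsRegular (CoordRing n) (List.ofFn x) := by
    refine isRegular_of_triangular hr' (a := fun _ => 1) (fun _ => one_ne_zero)
      (fun i => isHomogeneous_X _ _) (fun i => X_mem_supported.2 (Or.inl (by simp))) fun i => ?_
    simp [x]
  refine ⟨_, ⟨fun i => τ.symm (x i), fun i => ?_, ?_, rfl⟩, ?_⟩
  · change (linearSubst _ (X _)).IsHomogeneous 1
    rw [linearSubst, aeval_X]
    exact IsHomogeneous.sum _ _ _ fun _ _ => isHomogeneous_C_mul_X _ _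
  · refine (AddEquiv.isRegular_congr (e := τ.symm.toAddEquiv) ?_).1 hx
    rw [show (List.ofFn fun i => τ.symm (x i)) = (List.ofFn x).map τ.symm by
      rw [List.map_ofFn]; rfl]
    exact List.forall₂_map_right_iff.2 (List.forall₂_same.2 fun p _ q => map_mul τ.symm p q)
  · rw [Ideal.span_singleton_le_iff_mem]
    have h1 : τ F ∈ Ideal.span (Set.range x) := by
      refine mem_span_X_of_forall_eval_eq_zero hr' fun v hv => ?_
      change eval v (linearSubst _ F) = 0
      rw [eval_linearSubst]
      refine hFW _ ?_
      change b.equivFun.symm v ∈ W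
      rw [Basis.equivFun_symm_apply]
      refine W.sum_mem fun j _ => ?_
      by_cases hj : j.1 < r
      · have : v j = 0 := hv ⟨j, hj⟩
        rw [this, zero_smul]
        exact W.zero_mem
      · exact W.smul_mem _ (hb j (not_lt.1 hj))
    have h2 := Ideal.mem_map_of_mem τ.symm h1
    rw [Ideal.map_span, ← Set.range_comp, AlgEquiv.symm_apply_apply] at h2
    exact h2

end Planes

/-! ### Counting parameters -/

section DimensionCount

open MvPolynomial

variable {n r d : ℕ}

/-- Parameters for hypersurfaces containing a plane on which the coordinates in `J` are
independent: the coefficients expressing the other coordinates on the plane, and the coefficients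
of the monomials that involve another coordinate. -/
abbrev PlaneIndex (d : ℕ) (J : Finset (Fin (n + 1))) : Type :=
  ({k // k ∉ J} × J) ⊕ {m : {m : Fin (n + 1) →₀ ℕ // m.degree = d} // ¬ m.1.support ⊆ J}

variable {R : Type*} [CommRing R]

/-- Substitution of `∑ t ∈ J, c k t * x_t` for the variables `x_k`, `k ∉ J`. -/
noncomputable def planeSubst (J : Finset (Fin (n + 1))) (c : {k // k ∉ J} × J → R) :
    MvPolynomial (Fin (n + 1)) R →ₐ[R] MvPolynomial (Fin (n + 1)) R :=
  aeval fun k => if hk : k ∈ J then X k else ∑ t : J, C (c (⟨k, hk⟩, t)) * X t.1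

/-- The form with prescribed coefficients at the monomials that involve a variable outside `J`,
corrected so as to vanish on the plane given by `planeSubst`. -/
noncomputable def planeForm (J : Finset (Fin (n + 1))) (z : PlaneIndex d J → R) :
    MvPolynomial (Fin (n + 1)) R :=
  ∑ m : {m : {m : Fin (n + 1) →₀ ℕ // m.degree = d} // ¬ m.1.support ⊆ J},
    C (z (Sum.inr m)) *
      (monomial m.1.1 1 - planeSubst J (z ∘ Sum.inl) (monomial m.1.1 1))

lemma map_planeForm {R' : Type*} [CommRing R'] (φ : R →+* R') (J : Finset (Fin (n + 1)))
    (z : PlaneIndex d J → R) : map φ (planeForm J z) = planeForm J (φ ∘ z) := by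
  have h1 : ∀ p, map φ (planeSubst J (z ∘ Sum.inl) p) =
      planeSubst J (φ ∘ z ∘ Sum.inl) (map φ p) := by
    intro p
    induction p using MvPolynomial.induction_on with
    | C a => simp [planeSubst]
    | add p q hp hq => rw [map_add, map_add, hp, hq, map_add, map_add]
    | mul_X p k hp =>
      rw [map_mul, map_mul, hp, map_mul, map_mul]
      congr 1
      by_cases hk : k ∈ J <;> simp [planeSubst, hk, map_sum]
  simp only [planeForm, map_sum, map_mul, map_C, map_sub, h1, map_monomial, map_one]
  rfl

lemma planeSubst_monomial_of_support_subset (J : Finset (Fin (n + 1))) (c : {k // k ∉ J} × J → R)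
    {m : Fin (n + 1) →₀ ℕ} (hm : m.support ⊆ J) (a : R) :
    planeSubst J c (monomial m a) = monomial m a := by
  rw [planeSubst, aeval_monomial, monomial_eq]
  congr 1
  refine Finsupp.prod_congr fun k hk => ?_
  rw [dif_pos (hm hk)]

lemma eq_planeForm_of_planeSubst_eq_zero {J : Finset (Fin (n + 1))} {c : {k // k ∉ J} × J → R}
    {F : MvPolynomial (Fin (n + 1)) R} (hF : F.IsHomogeneous d) (h : planeSubst J c F = 0) :
    F = planeForm (d := d) J (Sum.elim c fun m => coeff m.1.1 F) := by
  classical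
  have h1 : F = ∑ m : {m : Fin (n + 1) →₀ ℕ // m.degree = d}, monomial m.1 (coeff m.1 F) := by
    ext m
    rw [coeff_sum]
    by_cases hm : m.degree = d
    · rw [Finset.sum_eq_single ⟨m, hm⟩]
      · simp
      · intro b _ hb
        rw [coeff_monomial, if_neg fun h => hb (Subtype.ext h)]
      · simp
    · rw [hF.coeff_eq_zero hm, Finset.sum_eq_zero]
      intro b _
      rw [coeff_monomial, if_neg]
      rintro rfl
      exact hm b.2
  have h2 : F = ∑ m : {m : Fin (n + 1) →₀ ℕ // m.degree = d},
      C (coeff m.1 F) * (monomial m.1 1 - planeSubst J c (monomial m.1 1)) := by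
    have h3 : ∀ (m : Fin (n + 1) →₀ ℕ) (a : R),
        C a * (monomial m 1 - planeSubst J c (monomial m 1)) =
          monomial m a - planeSubst J c (monomial m a) := by
      intro m a
      have h4 : monomial m a = a • monomial m (1 : R) := by rw [smul_monomial, smul_eq_mul, mul_one]
      rw [h4, map_smul, smul_eq_C_mul, smul_eq_C_mul, mul_sub]
    simp only [h3, Finset.sum_sub_distrib, ← map_sum]
    rw [← h1, h, sub_zero]
  conv_lhs => rw [h2]
  rw [planeForm, ← Fintype.sum_subtype_add_sum_subtype
    fun m : {m : Fin (n + 1) →₀ ℕ // m.degree = d} => m.1.support ⊆ J, Finset.sum_eq_zero, zero_add]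
  · rfl
  · intro m _
    rw [planeSubst_monomial_of_support_subset J c m.2, sub_self, mul_zero]

/-- A plane is a graph over a coordinate plane. -/
lemma exists_planeSubst_eq_zero {k : ℕ} {F : CoordRing n}
    {W : Submodule ℂ (Fin (n + 1) → ℂ)} (hW : W ∈ fanoVariety k F) :
    ∃ J : Finset (Fin (n + 1)), J.card = k + 1 ∧
      ∃ c : {k // k ∉ J} × J → ℂ, planeSubst J c F = 0 := by
  obtain ⟨hdim, hFW⟩ := hW
  have hspan : Submodule.span ℂ (Set.range fun k : Fin (n + 1) =>
      W.dualRestrict (LinearMap.proj k)) = ⊤ := by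
    have h1 : (fun k : Fin (n + 1) => W.dualRestrict (LinearMap.proj k)) =
        W.dualRestrict ∘ (Pi.basisFun ℂ (Fin (n + 1))).dualBasis := by
      ext k v
      simp
    rw [h1, Set.range_comp, Submodule.span_image, Basis.span_eq, Submodule.map_top,
      LinearMap.range_eq_top]
    exact Subspace.dualRestrict_surjective
  obtain ⟨J, hJ, hc⟩ := exists_pivots _ hspan
  rw [Subspace.dual_finrank_eq, hdim] at hJ
  choose c hc using hc
  have hc' : ∀ k, ∀ w ∈ W, w k = ∑ t : J, c k t * w t := fun k w hw => by
    have := LinearMap.congr_fun (hc k) ⟨w, hw⟩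
    simpa using this
  refine ⟨J, hJ, fun p => c p.1 p.2, MvPolynomial.funext fun v => ?_⟩
  -- a point of the plane with the same coordinates in `J` as `v`
  let res : W →ₗ[ℂ] (J → ℂ) := LinearMap.pi fun t => LinearMap.proj t.1 ∘ₗ W.subtype
  have hinj : Function.Injective res := by
    rw [injective_iff_map_eq_zero]
    rintro ⟨w, hw⟩ h0
    ext k
    have h1 : ∀ t : J, w t = 0 := fun t => congrFun h0 t
    simp [hc' k w hw, h1]
  have hsurj : Function.Surjective res := by
    rwa [← LinearMap.injective_iff_surjective_of_finrank_eq_finrank]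
    rw [finrank_fintype_fun_eq_card, Fintype.card_coe, hJ, hdim]
  obtain ⟨⟨w, hw⟩, hwv⟩ := hsurj fun t => v t
  have hwt : ∀ t : J, w t = v t := fun t => congrFun hwv t
  have h1 : (aeval v : CoordRing n →ₐ[ℂ] ℂ).comp (planeSubst J fun p => c p.1 p.2) =
      aeval w := by
    refine algHom_ext fun k => ?_
    by_cases hk : k ∈ J
    · simp [planeSubst, hk, hwt ⟨k, hk⟩]
    · simp [planeSubst, hk, hc' k w hw, hwt]
  rw [map_zero]
  have h2 := DFunLike.congr_fun h1 F
  exact h2.trans (hFW w hw)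

lemma card_planeIndex_lt (hr : r ≤ n) (h : (n - r + 1) * r < (n - r + d).choose d)
    {J : Finset (Fin (n + 1))} (hJ : J.card = n - r + 1) :
    Fintype.card (PlaneIndex d J) < Fintype.card {m : Fin (n + 1) →₀ ℕ // m.degree = d} := by
  classical
  have h1 : Fintype.card {k // k ∉ J} = r := by
    rw [Fintype.card_subtype_compl, Fintype.card_coe, hJ, Fintype.card_fin]
    omega
  have h2 : (n - r + d).choose d ≤
      Fintype.card {m : {m : Fin (n + 1) →₀ ℕ // m.degree = d} // m.1.support ⊆ J} := by
    have h3 : Fintype.card (Sym J d) = (n - r + d).choose d := by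
      rw [Sym.card_sym_eq_choose, Fintype.card_coe, hJ]
      congr 1
      omega
    rw [← h3]
    let f : Sym J d → {m : {m : Fin (n + 1) →₀ ℕ // m.degree = d} // m.1.support ⊆ J} :=
      fun s => ⟨symEquivExponent _ d (s.map Subtype.val), by
        intro k hk
        have : k ∈ s.1.map Subtype.val := by
          have : k ∈ (Multiset.toFinsupp (s.1.map Subtype.val)).support := hk
          simpa using this
        obtain ⟨k', -, rfl⟩ := Multiset.mem_map.1 this
        exact k'.2⟩
    refine Fintype.card_le_of_injective f fun s t hst => ?_
    have := congrArg Subtype.val hst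
    exact Sym.map_injective Subtype.val_injective d ((symEquivExponent _ d).injective this)
  rw [Fintype.card_sum, Fintype.card_prod, h1, Fintype.card_coe, hJ, Fintype.card_subtype_compl,
    mul_comm r]
  have h3 := Fintype.card_subtype_le
    fun m : {m : Fin (n + 1) →₀ ℕ // m.degree = d} => m.1.support ⊆ J
  omega

/-- If the binomial inequality fails, the hypersurfaces that contain an `(n - r)`-plane are not
dense: they are parametrized by finitely many affine spaces of too small a dimension. -/
lemma exists_eval_eq_zero_of_fanoVariety_nonempty (hr : r ≤ n)
    (h : (n - r + 1) * r < (n - r + d).choose d) :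
    ∃ Φ : MvPolynomial {m : Fin (n + 1) →₀ ℕ // m.degree = d} ℂ, Φ ≠ 0 ∧
      ∀ F : CoordRing n, F.IsHomogeneous d → (fanoVariety (n - r) F).Nonempty →
        eval (fun m => coeff m.1 F) Φ = 0 := by
  classical
  have key : ∀ J : Finset (Fin (n + 1)),
      ∃ Φ : MvPolynomial {m : Fin (n + 1) →₀ ℕ // m.degree = d} ℂ,
      Φ ≠ 0 ∧ (J.card = n - r + 1 →
        aeval (fun m => coeff m.1 (planeForm (d := d) J
          (X : _ → MvPolynomial (PlaneIndex d J) ℂ))) Φ = 0) := by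
    intro J
    by_cases hJ : J.card = n - r + 1
    · obtain ⟨Φ, h1, h2⟩ := exists_ne_zero_aeval_eq_zero
        (fun m : {m : Fin (n + 1) →₀ ℕ // m.degree = d} => coeff m.1 (planeForm (d := d) J
          (X : _ → MvPolynomial (PlaneIndex d J) ℂ))) (card_planeIndex_lt hr h hJ)
      exact ⟨Φ, h1, fun _ => h2⟩
    · exact ⟨1, one_ne_zero, fun h => absurd h hJ⟩
  choose Φ hΦ0 hΦ using key
  refine ⟨∏ J, Φ J, Finset.prod_ne_zero_iff.2 fun J _ => hΦ0 J, ?_⟩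
  rintro F hF ⟨W, hW⟩
  obtain ⟨J, hJ, c, hc⟩ := exists_planeSubst_eq_zero hW
  rw [map_prod]
  refine Finset.prod_eq_zero (Finset.mem_univ J) ?_
  set z : PlaneIndex d J → ℂ := Sum.elim c fun m => coeff m.1.1 F
  have h1 : ∀ m, coeff m F = eval z (coeff m (planeForm (d := d) J X)) := by
    intro m
    rw [← coeff_map, map_planeForm]
    conv_lhs => rw [eq_planeForm_of_planeSubst_eq_zero hF hc]
    congr 2
    ext j
    simp [z]
  have h2 : (aeval z : _ →ₐ[ℂ] ℂ).comp (aeval fun m : {m : Fin (n + 1) →₀ ℕ // m.degree = d} =>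
      coeff m.1 (planeForm (d := d) J X)) = aeval fun m => coeff m.1 F := by
    refine algHom_ext fun m => ?_
    rw [AlgHom.comp_apply, aeval_X, aeval_X, h1]
    rfl
  have h3 := DFunLike.congr_fun h2 (Φ J)
  rw [AlgHom.comp_apply, hΦ J hJ, map_zero] at h3
  exact h3.symm

lemma not_forGenericHypersurface_and {P Q : CoordRing n → Prop} (hPQ : ∀ F, ¬ (P F ∧ Q F))
    (hP : ForGenericHypersurface n d P) (hQ : ForGenericHypersurface n d Q) : False := by
  classical
  obtain ⟨Φ, hΦ, hP⟩ := hP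
  obtain ⟨Ψ, hΨ, hQ⟩ := hQ
  let m₀ : {m : Fin (n + 1) →₀ ℕ // m.degree = d} := ⟨Finsupp.single 0 d, by simp⟩
  -- the factor `X m₀` excludes the zero form
  have hne : Φ * Ψ * X m₀ ≠ 0 := mul_ne_zero (mul_ne_zero hΦ hΨ) (X_ne_zero _)
  obtain ⟨x, hx⟩ : ∃ x, eval x (Φ * Ψ * X m₀) ≠ 0 := by
    by_contra! h
    exact hne (MvPolynomial.funext fun x => by simpa using h x)
  let F : CoordRing n := ∑ m, monomial m.1 (x m)
  have hF : F.IsHomogeneous d := IsHomogeneous.sum _ _ _ fun m _ => isHomogeneous_monomial _ m.2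
  have hco : (fun m : {m : Fin (n + 1) →₀ ℕ // m.degree = d} => coeff m.1 F) = x := by
    ext m
    simp only [F, coeff_sum, coeff_monomial]
    rw [Finset.sum_eq_single m (fun b _ hb => if_neg fun h => hb (Subtype.ext h)) (by simp)]
    simp
  simp only [map_mul, eval_X, mul_ne_zero_iff] at hx
  have hF0 : F ≠ 0 := by
    intro h0
    apply hx.2
    rw [← congrFun hco m₀, h0, coeff_zero]
  exact hPQ F ⟨hP F hF hF0 (by rw [hco]; exact hx.1.1), hQ F hF hF0 (by rw [hco]; exact hx.1.2)⟩

end DimensionCount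

/-! ### The criterion -/

theorem mainTheorem4 (n d r : ℕ) (hd : 2 < d) (hr : r ≤ n) :
    (∀ a : Fin r → ℕ, (∀ i, a i = 1 ∨ a i = d - 1) →
      (ForGenericHypersurface n d (fun F => ContainsCI a F) ↔
          (n - r + d).choose d ≤ (n - r + 1) * r) ∧
      (¬ (n - r + d).choose d ≤ (n - r + 1) * r →
          ForGenericHypersurface n d (fun F => ¬ ContainsCI a F))) ∧
    (∀ F : CoordRing n, F.IsHomogeneous d → F ≠ 0 →
      (ContainsCI (fun _ : Fin r => 1) F ↔ (fanoVariety (n - r) F).Nonempty)) ∧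
    (ForGenericHypersurface n d (fun F => (fanoVariety (n - r) F).Nonempty) ↔
        (n - r + d).choose d ≤ (n - r + 1) * r) ∧
    (¬ (n - r + d).choose d ≤ (n - r + 1) * r →
        ForGenericHypersurface n d (fun F => fanoVariety (n - r) F = ∅)) := by
  obtain ⟨e, rfl⟩ : ∃ e, d = e + 1 := ⟨d - 1, by omega⟩
  rw [Nat.add_sub_cancel]
  have he : 2 ≤ e := by omega
  have hfano : ∀ a : Fin r → ℕ, (∀ i, a i = 1 ∨ a i = e) → ∀ F : CoordRing n,
      F.IsHomogeneous (e + 1) → ContainsCI a F → (fanoVariety (n - r) F).Nonempty := by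
    intro a ha F hF h
    obtain ⟨M, hM, hFM⟩ := exists_linear_forms_of_containsCI ha hF h
    exact fanoVariety_nonempty_of_mem_span hr hM hFM
  have hpos : (n - r + (e + 1)).choose (e + 1) ≤ (n - r + 1) * r →
      ∀ a : Fin r → ℕ, (∀ i, a i = 1 ∨ a i = e) →
        ForGenericHypersurface n (e + 1) fun F => ContainsCI a F := by
    intro h a ha
    obtain ⟨Φ, hΦ, hgen⟩ := exists_echelonSum_eq_of_generic he hr h
    refine ⟨Φ, hΦ, fun F hF _ hFΦ => ?_⟩
    obtain ⟨z, rfl, hz⟩ := hgen F hF hFΦ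
    exact containsCI_echelonSum he hr ha z hz
  have hneg : ¬ (n - r + (e + 1)).choose (e + 1) ≤ (n - r + 1) * r →
      ForGenericHypersurface n (e + 1) fun F => ¬ (fanoVariety (n - r) F).Nonempty := by
    intro h
    obtain ⟨Φ, hΦ, hzero⟩ := exists_eval_eq_zero_of_fanoVariety_nonempty hr (not_le.1 h)
    exact ⟨Φ, hΦ, fun F hF _ hFΦ hne => hFΦ (hzero F hF hne)⟩
  have hnegCI : ∀ a : Fin r → ℕ, (∀ i, a i = 1 ∨ a i = e) →
      ¬ (n - r + (e + 1)).choose (e + 1) ≤ (n - r + 1) * r →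
      ForGenericHypersurface n (e + 1) fun F => ¬ ContainsCI a F := by
    intro a ha h
    obtain ⟨Φ, hΦ, hF⟩ := hneg h
    exact ⟨Φ, hΦ, fun F hFd hF0 hFΦ hCI => hF F hFd hF0 hFΦ (hfano a ha F hFd hCI)⟩
  have hiff : ∀ F : CoordRing n, F.IsHomogeneous (e + 1) →
      (ContainsCI (fun _ : Fin r => 1) F ↔ (fanoVariety (n - r) F).Nonempty) := fun F hF =>
    ⟨hfano _ (fun _ => Or.inl rfl) F hF, fun ⟨_, hW⟩ => containsCI_one_of_mem_fanoVariety hr hW⟩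
  refine ⟨fun a ha => ⟨⟨fun h => ?_, fun h => hpos h a ha⟩, hnegCI a ha⟩, fun F hF _ => hiff F hF,
    ⟨fun h => ?_, fun h => ?_⟩, fun h => ?_⟩
  · by_contra hcon
    exact not_forGenericHypersurface_and (fun F => and_not_self) h (hnegCI a ha hcon)
  · by_contra hcon
    exact not_forGenericHypersurface_and (fun F => and_not_self) h (hneg hcon)
  · obtain ⟨Φ, hΦ, hF⟩ := hpos h (fun _ => 1) fun _ => Or.inl rfl
    exact ⟨Φ, hΦ, fun F hFd hF0 hFΦ => (hiff F hFd).1 (hF F hFd hF0 hFΦ)⟩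
  · simpa only [Set.not_nonempty_iff_eq_empty] using hneg h
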